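/- Let $q$ be real, $0<|q|<1$, put $(x;q)_k=\prod_{j=0}^{k-1}(1-xq^j)$, $(x;q)_\infty=\prod_{j\ge 0}(1-xq^j)$ and $(x_1,\dots,x_r;q)_k=(x_1;q)_k\cdots(x_r;q)_k$ (also for $k=\infty$), and let ${}_8\varphi_7$ be the basic hypergeometric series $${}_8\varphi_7\!\left({a_1,\dots,a_8\atop b_1,\dots,b_7};q,t\right)=\sum_{k\ge 0}\frac{(a_1,\dots,a_8;q)_k}{(q,b_1,\dots,b_7;q)_k}\,t^k .$$ Let $\alpha,d$ be real, $\alpha\neq 0$, $|q|<|d|$, and let $a,b,c$ be nonzero complex numbers of modulus less than $1$ which are either all real, or such that two of them are complex conjugates of each other and the third is real. For $x=\frac12(w+w^{-1})$ and $|bcq^\nu|<1$ let $$u_\nu(x;a,b,c;d)=\frac{(qa/d,\,bcq^\nu,\,q^{1-\nu}w/d,\,q^{1-\nu}w^{-1}/d;q)_\infty}{(q^{1-\nu}a/d,\,bc,\,qw/d,\,qw^{-1}/d;q)_\infty}\;{}_8\varphi_7\!\left({\frac{aq^{-\nu}}{d},\,q\sqrt{\frac{aq^{-\nu}}{d}},\,-q\sqrt{\frac{aq^{-\nu}}{d}},\,q^{-\nu},\,\frac{q^{1-\nu}}{bd},\,\frac{q^{1-\nu}}{cd},\,aw,\,aw^{-1}\atop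 \sqrt{\frac{aq^{-\nu}}{d}},\,-\sqrt{\frac{aq^{-\nu}}{d}},\,\frac{aq}{d},\,ab,\,ac,\,\frac{q^{1-\nu}w}{d},\,\frac{q^{1-\nu}w^{-1}}{d}};q,\,bcq^\nu\right),$$ where values of $\nu$ at which a denominator vanishes (removable singularities) are filled in by continuity in $\nu$. Let $-1<\cos\theta<1$ with $\theta$ real, and let $\gamma_n$ be complex numbers with $q^{\gamma_n}=q^n/(\alpha d)$ for $n=1,2,\dots$. Put $$A(e^{i\theta})=\frac{(ae^{i\theta},be^{i\theta},ce^{i\theta},\alpha e^{-i\theta},qe^{i\theta}/\alpha;q)_\infty}{(e^{2i\theta},qe^{-i\theta}/d;q)_\infty},\qquad \chi=\arg A(e^{i\theta}).$$ Then $A(e^{i\theta})\ne 0$, and as $n\to\infty$ $$u_{\gamma_n}(\cos\theta;a,b,c;d)=\frac{2(-\alpha)^{n-1}q^{-n(n-1)/2}}{(ab,ac,bc;q)_\infty}\Big(|A(e^{i\theta})|\cos\big((n-1)\theta-\chi\big)+o(1)\Big).$$ Moreover $$|A(e^{i\theta})|^{-2}=\frac{(e^{2i\theta},e^{-2i\theta};q)_\infty}{(ae^{i\theta},ae^{-i\theta},be^{i\theta},be^{-i\theta},ce^{i\theta},ce^{-i\theta};q)_\infty}\cdot\frac{(qe^{i\theta}/d,\,qe^{-i\theta}/d;q)_\infty}{(\alpha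 e^{i\theta},\alpha e^{-i\theta},qe^{i\theta}/\alpha,qe^{-i\theta}/\alpha;q)_\infty},$$ which is the weight function in the orthogonality relation of the functions $u_\nu(\cos\theta;a,b,c;d)$ on $0\le\theta\le\pi$. -/

import Mathlib

open Filter Topology Asymptotics

/-- The `q`-shifted factorial `(a; q)_n = ∏_{k < n} (1 - a q^k)`. -/
noncomputable def qPoch (q a : ℂ) (n : ℕ) : ℂ := ∏ k ∈ Finset.range n, (1 - a * q ^ k)

/-- `(a₁, …, a_r; q)_n = (a₁; q)_n ⋯ (a_r; q)_n`. -/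
noncomputable def qPochList (q : ℂ) (as : List ℂ) (n : ℕ) : ℂ :=
  (as.map fun a => qPoch q a n).prod

/-- `(a; q)_∞ = ∏_{k ≥ 0} (1 - a q^k)`, for `|q| < 1`. -/
noncomputable def qPochInf (q a : ℂ) : ℂ := ∏' k : ℕ, (1 - a * q ^ k)

/-- `(a₁, …, a_r; q)_∞ = (a₁; q)_∞ ⋯ (a_r; q)_∞`. -/
noncomputable def qPochInfList (q : ℂ) (as : List ℂ) : ℂ :=
  (as.map fun a => qPochInf q a).prod

/-- The basic hypergeometric series `_rφ_s(a₁, …, a_r; b₁, …, b_s; q, t)`. -/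
noncomputable def basicHyp (q : ℂ) (as bs : List ℂ) (t : ℂ) : ℂ :=
  ∑' n : ℕ, qPochList q as n / qPochList q (q :: bs) n *
    ((-1) ^ n * q ^ (n * (n - 1) / 2)) ^ (1 + (bs.length : ℤ) - (as.length : ℤ)) * t ^ n

/-- The very-well-poised `₈φ₇` expression for `u_ν(x; a, b, c; d)`, where `x = (w + w⁻¹) / 2`
(so `w` stands for `q^z`). The series converges for `|b c q^ν| < 1`; as a function of `ν` the
expression is analytic there except for isolated removable singularities, where a denominator
factor vanishes. -/
noncomputable def uSeries (q a b c d w ν : ℂ) : ℂ :=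
  qPochInfList q [q * a / d, b * c * q ^ ν, q ^ (1 - ν) * w / d, q ^ (1 - ν) * w⁻¹ / d] /
      qPochInfList q [q ^ (1 - ν) * a / d, b * c, q * w / d, q * w⁻¹ / d] *
    basicHyp q
      [a * q ^ (-ν) / d, q * (a * q ^ (-ν) / d) ^ (1 / 2 : ℂ),
        -(q * (a * q ^ (-ν) / d) ^ (1 / 2 : ℂ)),
        q ^ (-ν), q ^ (1 - ν) / (b * d), q ^ (1 - ν) / (c * d), a * w, a * w⁻¹]
      [(a * q ^ (-ν) / d) ^ (1 / 2 : ℂ), -(a * q ^ (-ν) / d) ^ (1 / 2 : ℂ),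
        a * q / d, a * b, a * c, q ^ (1 - ν) * w / d, q ^ (1 - ν) * w⁻¹ / d]
      (b * c * q ^ ν)

/-- The function `u_ν(x; a, b, c; d)`, `x = (w + w⁻¹) / 2`, for `|b c q^ν| < 1`: the `₈φ₇`
expression, with its removable singularities in `ν` filled in by continuity. -/
noncomputable def uFun (q a b c d w ν : ℂ) : ℂ :=
  limUnder (𝓝[≠] ν) fun μ => uSeries q a b c d w μ

/-- `A(w) = (aw, bw, cw, αw⁻¹, qw/α; q)_∞ / (w², qw⁻¹/d; q)_∞`. -/
noncomputable def ampA (q a b c d α w : ℂ) : ℂ :=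
  qPochInfList q [a * w, b * w, c * w, α * w⁻¹, q * w / α] /
    qPochInfList q [w ^ 2, q * w⁻¹ / d]

/-- The weight function (with `w = e^{iθ}`) in the orthogonality relation on `0 ≤ θ ≤ π` of the
functions `u_ν(cos θ; a, b, c; d)`. -/
noncomputable def orthWeight (q a b c d α w : ℂ) : ℂ :=
  qPochInfList q [w ^ 2, (w⁻¹) ^ 2] /
      qPochInfList q [a * w, a * w⁻¹, b * w, b * w⁻¹, c * w, c * w⁻¹] *
    (qPochInfList q [q * w / d, q * w⁻¹ / d] /
      qPochInfList q [α * w, α * w⁻¹, q * w / α, q * w⁻¹ / α])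

/-! The `₈φ₇` splits into two balanced series exchanged by w ↔ w⁻¹, and the asymptotics can be read
off from each of them term by term.

For the splitting, put s = q^{-ν}/d and ε = q^ν, and forget the relation sε = 1/d. For fixed s, both
sides of `wpSeries_eq_expansion` are holomorphic in ε on a disc around 0, so it suffices to compare
them at ε = q^N, a sequence accumulating at 0. There the very-well-poised series terminates, and
Watson's transformation (`watson_terminating`) turns it into a balanced `₄φ₃`. On the other side, a
terminating q-Saalschütz expansion trades ε for the shifts a → aq^j, and the nonterminating
q-Saalschütz sum (`saalSeries_eq`) adds the two branches up to the same `₄φ₃` (`expansion_pow`).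

At ν = γ_{m+1} one has qs = α/q^m. The product (αw⁻¹/q^m; q)_∞ carries the growth (-α)^m
q^{-m(m+1)/2} w^{-m}. After division by this product only the k = 0 term of the series survives
(`tendsto_branchSeries_div`); the bounds hold because q is real and w is not, so that real multiples
of w⁻¹ miss the zeros of the product. The branches contribute amplitudes tending to A(w) and A(w⁻¹).
These are complex conjugates by the assumption on a, b, c (`conj_ampA`), so together they give 2
Re(w^{-m} A), which is the cosine. The weight is 1/(A(w) A(w⁻¹)). -/

/-! ### Finite q-shifted factorials. -/

section qPoch

variable (q a : ℂ)

@[simp] theorem qPoch_zero : qPoch q a 0 = 1 := by simp [qPoch]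

theorem qPoch_succ (n : ℕ) : qPoch q a (n + 1) = qPoch q a n * (1 - a * q ^ n) := by
  simp [qPoch, Finset.prod_range_succ]

theorem qPoch_succ_left (n : ℕ) : qPoch q a (n + 1) = (1 - a) * qPoch q (a * q) n := by
  simp only [qPoch, Finset.prod_range_succ', pow_zero, mul_one]
  rw [mul_comm]
  congr 1
  exact Finset.prod_congr rfl fun k _ => by ring

theorem qPoch_add (m n : ℕ) : qPoch q a (m + n) = qPoch q a m * qPoch q (a * q ^ m) n := by
  simp only [qPoch, Finset.prod_range_add]
  congr 1
  exact Finset.prod_congr rfl fun k _ => by ring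

theorem qPoch_ne_zero {q a : ℂ} {n : ℕ} (h : ∀ k < n, a * q ^ k ≠ 1) : qPoch q a n ≠ 0 :=
  Finset.prod_ne_zero_iff.2 fun k hk => sub_ne_zero.2 (h k (Finset.mem_range.1 hk)).symm

end qPoch

theorem sum_range_eq_of_telescope (f g : ℕ → ℂ) (n : ℕ) (h0 : f 0 = g 0)
    (h : ∀ k < n, f (k + 1) = g (k + 1) - g k) : ∑ k ∈ Finset.range (n + 1), f k = g n := by
  induction n with
  | zero => simpa using h0
  | succ n ih =>
    rw [Finset.sum_range_succ, ih fun k hk => h k (by omega), h n (by omega)]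
    ring

/-! ### Terminating sums: q-Saalschütz, `₆φ₅`, and Watson's transformation. -/

/-- The summand of the terminating `q`-Saalschütz sum, in symmetric form. -/
noncomputable def saalTerm (q a b e : ℂ) (n k : ℕ) : ℂ :=
  qPoch q a k * qPoch q b k * qPoch q e (n - k) * e ^ k * qPoch q (a * b * e * q ^ k) (n - k) /
    (qPoch q q k * qPoch q q (n - k))

/-- The `q`-Pfaff–Saalschütz summation. -/
theorem sum_saalTerm {q : ℂ} (hq : ∀ n, qPoch q q n ≠ 0) (a b e : ℂ) (n : ℕ) :
    ∑ k ∈ Finset.range (n + 1), saalTerm q a b e n k =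
      qPoch q (b * e) n * qPoch q (a * e) n / qPoch q q n := by
  induction n with
  | zero => simp [saalTerm]
  | succ n ih =>
    have hq1 : ∀ m, 1 - q * q ^ m ≠ 0 := fun m h => hq (m + 1) (by rw [qPoch_succ, h, mul_zero])
    -- A Zeilberger certificate: the combination of the summands for n + 1 and n dictated by the
    -- recurrence of the right-hand side is a difference in k. The leftover term k = n + 1 cancels
    -- the boundary value of the antiderivative.
    have key := sum_range_eq_of_telescope
      (fun k => (1 - q * q ^ n) * saalTerm q a b e (n + 1) k -
        (1 - b * e * q ^ n) * (1 - a * e * q ^ n) * saalTerm q a b e n k)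
      (fun k => -(q ^ (n - k) * e * (1 - a * q ^ k) * (1 - b * q ^ k) * saalTerm q a b e n k)) n
      (by
        have := hq1 n
        have := hq n
        simp only [saalTerm, Nat.sub_zero, qPoch_succ, qPoch_zero, pow_zero]
        field_simp
        ring)
      (by
        intro k hk
        obtain ⟨r, rfl⟩ : ∃ r, n = k + 1 + r := ⟨n - (k + 1), by omega⟩
        have e1 : k + 1 + r + 1 - (k + 1) = r + 1 := by omega
        have e2 : k + 1 + r - (k + 1) = r := by omega
        have e3 : k + 1 + r - k = r + 1 := by omega
        have e4 : qPoch q (a * b * e * q ^ k) (r + 1) =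
            (1 - a * b * e * q ^ k) * qPoch q (a * b * e * q ^ (k + 1)) r := by
          rw [qPoch_succ_left, mul_assoc _ (q ^ k) q, pow_succ]
        have := hq1 k
        have := hq1 r
        have := hq k
        have := hq r
        simp only [saalTerm, e1, e2, e3, e4]
        simp only [qPoch_succ]
        field_simp
        ring)
    rw [Finset.sum_sub_distrib, ← Finset.mul_sum, ← Finset.mul_sum, ih] at key
    have hl := hq1 n
    have hl' := hq n
    rw [Finset.sum_range_succ, ← mul_right_inj' hl, mul_add]
    rw [sub_eq_iff_eq_add] at key
    rw [key]
    simp only [saalTerm, Nat.sub_self, qPoch_succ, qPoch_zero, pow_zero, pow_succ e]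
    generalize q ^ n = x at hl ⊢
    generalize hu : 1 - q * x = u at hl ⊢
    field_simp
    subst hu
    ring

/-- The factor of the very-well-poised terms which does not depend on the length of the sum. -/
noncomputable def vwpCoeff (q y B C : ℂ) (k : ℕ) : ℂ :=
  (∏ i ∈ Finset.range k, -q ^ i) * y ^ k * qPoch q B k * qPoch q C k /
    (qPoch q (y * C) k * qPoch q (y * B) k * qPoch q q k)

theorem vwpCoeff_succ (q y B C : ℂ) (k : ℕ) :
    vwpCoeff q y B C (k + 1) = vwpCoeff q y B C k *
      (-q ^ k * y * (1 - B * q ^ k) * (1 - C * q ^ k) /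
        ((1 - y * C * q ^ k) * (1 - y * B * q ^ k) * (1 - q * q ^ k))) := by
  simp only [vwpCoeff, qPoch_succ, Finset.prod_range_succ, div_mul_div_comm, pow_succ]
  congr 1 <;> ring

/-- The summand of the terminating very-well-poised `₆φ₅`. -/
noncomputable def vwpTerm (q A y B C : ℂ) (n k : ℕ) : ℂ :=
  vwpCoeff q y B C k * (1 - A * q ^ (2 * k)) /
    (qPoch q q (n - k) * qPoch q (A * q ^ k) (n + 1))

/-- The terminating very-well-poised `₆φ₅` summation. -/
theorem sum_vwpTerm {q A y B C : ℂ} (hq : ∀ n, qPoch q q n ≠ 0) (hA : ∀ n, A * q ^ n ≠ 1)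
    (hAy : A * q = y * B * C) (hB : ∀ n, qPoch q (y * B) n ≠ 0)
    (hC : ∀ n, qPoch q (y * C) n ≠ 0) (n : ℕ) :
    ∑ k ∈ Finset.range (n + 1), vwpTerm q A y B C n k =
      qPoch q y n / (qPoch q q n * qPoch q (y * C) n * qPoch q (y * B) n) := by
  have hA' : ∀ n, 1 - A * q ^ n ≠ 0 := fun n => sub_ne_zero.2 (hA n).symm
  have hAk : ∀ k n, qPoch q (A * q ^ k) n ≠ 0 := fun k n => qPoch_ne_zero fun j _ => by
    rw [mul_assoc, ← pow_add]; exact hA _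
  have hq1 : ∀ m, 1 - q * q ^ m ≠ 0 := fun m h => hq (m + 1) (by rw [qPoch_succ, h, mul_zero])
  have hB1 : ∀ m, 1 - y * B * q ^ m ≠ 0 := fun m h => hB (m + 1) (by rw [qPoch_succ, h, mul_zero])
  have hC1 : ∀ m, 1 - y * C * q ^ m ≠ 0 := fun m h => hC (m + 1) (by rw [qPoch_succ, h, mul_zero])
  induction n with
  | zero =>
    have := hA' 0
    simp only [pow_zero, mul_one] at this
    simp [vwpTerm, vwpCoeff, qPoch, this]
  | succ n ih =>
    -- The same method: the weights are those of the first-order recurrence in n of the closed form,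
    -- and the second function is the certificate.
    have key := sum_range_eq_of_telescope
      (fun k => (1 - q * q ^ n) * (1 - y * C * q ^ n) * (1 - y * B * q ^ n) *
          vwpTerm q A y B C (n + 1) k - (1 - y * q ^ n) * vwpTerm q A y B C n k)
      (fun k => y * q ^ n * vwpCoeff q y B C k * (1 - B * q ^ k) * (1 - C * q ^ k) /
        (qPoch q q (n - k) * qPoch q (A * q ^ (k + 1)) (n + 1))) n
      (by
        have h1 := hA' 0
        have h2 := hAk 1 n
        have h3 := hA' (n + 1)
        have h4 := hq n
        have h5 := hq1 n
        have e1 : A * q ^ (n + 1) = y * B * C * q ^ n := by rw [pow_succ', ← mul_assoc, hAy]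
        rw [pow_zero, mul_one] at h1
        rw [e1] at h3
        simp only [pow_one] at h2
        simp only [vwpTerm, Nat.sub_zero, mul_zero, pow_zero, mul_one, qPoch_succ_left q A,
          zero_add, pow_one]
        rw [qPoch_succ q (A * q) n, qPoch_succ, show A * q * q ^ n = y * B * C * q ^ n by rw [hAy]]
        rw [hAy] at h2 ⊢
        simp only [vwpCoeff, qPoch_zero, Finset.range_zero, Finset.prod_empty, pow_zero]
        generalize q ^ n = x at *
        generalize 1 - A = u1 at *
        generalize hu2 : 1 - y * B * C * x = u2 at *
        generalize hu3 : 1 - q * x = u3 at *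
        field_simp
        subst hu2 hu3
        ring)
      (by
        intro k hk
        obtain ⟨r, rfl⟩ : ∃ r, n = k + 1 + r := ⟨n - (k + 1), by omega⟩
        have e1 : k + 1 + r + 1 - (k + 1) = r + 1 := by omega
        have e2 : k + 1 + r - (k + 1) = r := by omega
        have e3 : k + 1 + r - k = r + 1 := by omega
        have e5 : A * q ^ (k + 1) = y * B * C * q ^ k := by rw [pow_succ', ← mul_assoc, hAy]
        have e6 : A * q ^ (2 * (k + 1)) = y * B * C * q * q ^ k * q ^ k := by
          rw [← hAy]; ring
        have h1 := hA' (k + 1)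
        have h2 := hAk (k + 1) (k + 1 + r + 1)
        have h3 := hA' (2 * k + r + 3)
        have e7 : A * q ^ (2 * k + r + 3) = y * B * C * q ^ k * (q ^ k * q ^ r * q ^ 2) := by
          rw [← hAy]; ring
        have e8 : q ^ (k + 1 + r) = q * q ^ k * q ^ r := by ring
        have e9 : q ^ (k + 1 + r + 1) = q ^ k * q ^ r * q ^ 2 := by ring
        have e4 : qPoch q (A * q ^ (k + 1 + 1)) (k + 1 + r + 1) =
            qPoch q (A * q ^ (k + 1)) (k + 1 + r + 1) *
              (1 - y * B * C * q ^ k * (q ^ k * q ^ r * q ^ 2)) / (1 - y * B * C * q ^ k) := by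
          rw [e5] at h1
          rw [eq_div_iff h1, ← e9, ← e5, mul_comm, pow_succ q (k + 1), ← mul_assoc A,
            ← qPoch_succ_left, qPoch_succ]
        have h4 := hq1 k
        have h5 := hq1 r
        have h6 := hq r
        have h7 := hB1 k
        have h8 := hC1 k
        rw [e7] at h3
        simp only [vwpTerm, e1, e2, e3, e4, vwpCoeff_succ]
        rw [qPoch_succ q (A * q ^ (k + 1)) (k + 1 + r + 1), e9, e6, qPoch_succ q q r, e8]
        rw [e5] at h1 h2 ⊢
        generalize qPoch q (y * B * C * q ^ k) (k + 1 + r + 1) = W at *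
        generalize vwpCoeff q y B C k = c at *
        generalize qPoch q q r = Q at *
        rw [pow_two] at h3 ⊢
        simp only [pow_succ q]
        generalize q ^ k = x at *
        generalize q ^ r = z at *
        -- Each denominator becomes an atom before `field_simp` and is restored for `ring`, which
        -- keeps the rational identity manageable.
        clear e4 e5 e6 e7 e8 e9 ih
        generalize hu1 : 1 - y * B * C * x = u1 at *
        generalize hu2 : 1 - q * x = u2 at *
        generalize hu3 : 1 - y * B * x = u3 at *
        generalize hu4 : 1 - y * C * x = u4 at *
        generalize hu5 : 1 - q * z = u5 at *
        generalize hu6 : 1 - y * B * C * x * (x * z * (q * q)) = u6 at *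
        field_simp
        subst hu1 hu2 hu3 hu4 hu5 hu6
        ring)
    rw [Finset.sum_sub_distrib, ← Finset.mul_sum, ← Finset.mul_sum, ih, sub_eq_iff_eq_add] at key
    have h1 := hq1 n
    have h2 := hq n
    have h3 := hB1 n
    have h4 := hC1 n
    have h5 := hB n
    have h6 := hC n
    have h7 : (1 - q * q ^ n) * (1 - y * C * q ^ n) * (1 - y * B * q ^ n) ≠ 0 := by positivity
    have e5 : A * q ^ (n + 1) = y * B * C * q ^ n := by rw [pow_succ', ← mul_assoc, hAy]
    have e6 : A * q ^ (2 * (n + 1)) = y * B * C * q * q ^ n * q ^ n := by rw [← hAy]; ring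
    have h8 := hAk (n + 1) (n + 1)
    have h9 := hA' (2 * n + 2)
    rw [Finset.sum_range_succ, ← mul_right_inj' h7, mul_add, key]
    simp only [vwpTerm, Nat.sub_self, vwpCoeff_succ, qPoch_zero]
    rw [qPoch_succ q (A * q ^ (n + 1)) (n + 1), qPoch_succ q q n, qPoch_succ q (y * C) n,
      qPoch_succ q (y * B) n, qPoch_succ q y n, e6, mul_assoc A, ← pow_add]
    rw [show n + 1 + (n + 1) = 2 * n + 2 by ring,
      show A * q ^ (2 * n + 2) = y * B * C * q * q ^ n * q ^ n by rw [← hAy]; ring] at *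
    clear key e5 e6 ih
    generalize qPoch q (A * q ^ (n + 1)) (n + 1) = W at *
    generalize vwpCoeff q y B C n = c at *
    generalize q ^ n = x at *
    generalize hu1 : 1 - y * B * C * q * x * x = u1 at *
    generalize hu2 : 1 - q * x = u2 at *
    generalize hu3 : 1 - y * B * x = u3 at *
    generalize hu4 : 1 - y * C * x = u4 at *
    field_simp
    subst hu1 hu2 hu3 hu4
    ring

/-- The terminating Watson transformation between a very-well-poised `₈φ₇` and a balanced `₄φ₃`,
for parameters `A = a s`, `a e = q s`. -/
theorem watson_terminating {q a s e w A y B C : ℂ} (hq : ∀ n, qPoch q q n ≠ 0)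
    (hw : w ≠ 0) (ha : a ≠ 0) (he : a * e = q * s) (hAs : A = a * s)
    (hA : ∀ n, A * q ^ n ≠ 1) (hAy : A * q = y * B * C) (hB : ∀ n, qPoch q (y * B) n ≠ 0)
    (hC : ∀ n, qPoch q (y * C) n ≠ 0) (N : ℕ) :
    ∑ k ∈ Finset.range (N + 1), vwpCoeff q y B C k * e ^ k * (1 - A * q ^ (2 * k)) /
        (qPoch q q (N - k) * qPoch q (A * q ^ k) (N + 1)) *
        (qPoch q (a * w) k * qPoch q (a * w⁻¹) k) *
        (qPoch q (q * s * w * q ^ k) (N - k) * qPoch q (q * s * w⁻¹ * q ^ k) (N - k)) =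
      ∑ j ∈ Finset.range (N + 1), qPoch q y j * qPoch q e (N - j) * e ^ j *
        (qPoch q (a * w) j * qPoch q (a * w⁻¹) j) /
        (qPoch q q j * qPoch q q (N - j) * qPoch q (y * C) j * qPoch q (y * B) j) := by
  have hAk : ∀ k n, qPoch q (A * q ^ k) n ≠ 0 := fun k n => qPoch_ne_zero fun j _ => by
    rw [mul_assoc, ← pow_add]; exact hA _
  have hinner : ∀ k ∈ Finset.range (N + 1),
      vwpCoeff q y B C k * e ^ k * (1 - A * q ^ (2 * k)) /
        (qPoch q q (N - k) * qPoch q (A * q ^ k) (N + 1)) *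
        (qPoch q (a * w) k * qPoch q (a * w⁻¹) k) *
        (qPoch q (q * s * w * q ^ k) (N - k) * qPoch q (q * s * w⁻¹ * q ^ k) (N - k)) =
      ∑ i ∈ Finset.range (N + 1 - k), (fun k i => vwpTerm q A y B C (k + i) k *
        (qPoch q e (N - (k + i)) * e ^ (k + i) *
        (qPoch q (a * w) (k + i) * qPoch q (a * w⁻¹) (k + i)) / qPoch q q (N - (k + i)))) k i := by
    intro k hk
    obtain ⟨M, rfl⟩ : ∃ M, N = k + M := ⟨N - k, by have := Finset.mem_range.1 hk; omega⟩
    have e1 : k + M + 1 - k = M + 1 := by omega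
    -- Since ae = qs, the last two products are the right-hand side of a Saalschütz sum of length M
    -- = N - k with both parameters shifted by q^k.
    have hs := sum_saalTerm hq (a * w * q ^ k) (a * w⁻¹ * q ^ k) e M
    rw [show a * w⁻¹ * q ^ k * e = q * s * w⁻¹ * q ^ k by linear_combination w⁻¹ * q ^ k * he,
      show a * w * q ^ k * e = q * s * w * q ^ k by linear_combination w * q ^ k * he] at hs
    rw [e1, Nat.add_sub_cancel_left]
    have h1 := hq M
    have h2 : qPoch q (q * s * w * q ^ k) M * qPoch q (q * s * w⁻¹ * q ^ k) M =
        qPoch q q M * ∑ i ∈ Finset.range (M + 1),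
          saalTerm q (a * w * q ^ k) (a * w⁻¹ * q ^ k) e M i := by
      rw [hs]; field_simp
    rw [h2, Finset.mul_sum, Finset.mul_sum]
    refine Finset.sum_congr rfl fun i hi => ?_
    obtain ⟨r, rfl⟩ : ∃ r, M = i + r := ⟨M - i, by have := Finset.mem_range.1 hi; omega⟩
    have e2 : k + (i + r) - (k + i) = r := by omega
    simp only [saalTerm, vwpTerm, e2, Nat.add_sub_cancel_left]
    have e3 : qPoch q (A * q ^ k) (k + (i + r) + 1) = qPoch q (A * q ^ k) (k + i + 1) *
        qPoch q (a * w * q ^ k * (a * w⁻¹ * q ^ k) * e * q ^ i) r := by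
      rw [show k + (i + r) + 1 = k + i + 1 + r by omega, qPoch_add]
      congr 2
      rw [hAs]
      field_simp
      linear_combination -(q ^ (2 * k + i)) * he
    have h3 := hAk k (k + (i + r) + 1)
    rw [e3] at h3 ⊢
    have h4 := left_ne_zero_of_mul h3
    have h5 := right_ne_zero_of_mul h3
    rw [qPoch_add q (a * w) k i, qPoch_add q (a * w⁻¹) k i]
    generalize qPoch q (a * w * q ^ k * (a * w⁻¹ * q ^ k) * e * q ^ i) r = W at *
    have h6 := hq r
    have h7 := hq i
    rw [pow_add e k i]
    field_simp
  -- Regrouping the double sum by j = k + i leaves, for each j, a `₆φ₅` in k.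
  rw [Finset.sum_congr rfl hinner, ← Finset.sum_range_diag_flip]
  refine Finset.sum_congr rfl fun j hj => ?_
  have hj' : j ≤ N := by have := Finset.mem_range.1 hj; omega
  have : ∀ k ∈ Finset.range (j + 1), vwpTerm q A y B C (k + (j - k)) k *
        (qPoch q e (N - (k + (j - k))) * e ^ (k + (j - k)) *
        (qPoch q (a * w) (k + (j - k)) * qPoch q (a * w⁻¹) (k + (j - k))) /
          qPoch q q (N - (k + (j - k)))) =
      vwpTerm q A y B C j k * (qPoch q e (N - j) * e ^ j *
        (qPoch q (a * w) j * qPoch q (a * w⁻¹) j) / qPoch q q (N - j)) := by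
    intro k hk
    rw [Nat.add_sub_cancel' (by have := Finset.mem_range.1 hk; omega)]
  rw [Finset.sum_congr rfl this, ← Finset.sum_mul, sum_vwpTerm hq hA hAy hB hC, div_mul_div_comm]
  congr 1 <;> ring

/-! ### Infinite products: analyticity and uniform bounds. -/

section qPochInf

variable {q : ℂ}

theorem summable_norm_mul_pow (hq : ‖q‖ < 1) (a : ℂ) : Summable fun k : ℕ => ‖-(a * q ^ k)‖ := by
  simp only [norm_neg, norm_mul, norm_pow]
  exact (summable_geometric_of_lt_one (norm_nonneg _) hq).mul_left _

theorem multipliable_qPochInf (hq : ‖q‖ < 1) (a : ℂ) :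
    Multipliable fun k : ℕ => 1 - a * q ^ k := by
  simpa only [sub_eq_add_neg] using multipliable_one_add_of_summable (summable_norm_mul_pow hq a)

theorem qPochInf_eq_mul (hq : ‖q‖ < 1) (a : ℂ) (n : ℕ) :
    qPochInf q a = qPoch q a n * qPochInf q (a * q ^ n) := by
  have e : (fun k : ℕ => 1 - a * q ^ n * q ^ k) = fun k : ℕ => 1 - a * q ^ (k + n) := by
    funext k
    ring
  have h := multipliable_qPochInf hq (a * q ^ n)
  rw [e] at h
  have h2 := Multipliable.prod_mul_tprod_nat_mul' (f := fun k : ℕ => 1 - a * q ^ k) (k := n) h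
  rw [qPochInf, ← h2, qPoch, qPochInf, e]

theorem qPochInf_eq_mul_one (hq : ‖q‖ < 1) (a : ℂ) :
    qPochInf q a = (1 - a) * qPochInf q (a * q) := by
  simpa [qPoch] using qPochInf_eq_mul hq a 1

theorem qPochInf_ne_zero (hq : ‖q‖ < 1) {a : ℂ} (h : ∀ k : ℕ, a * q ^ k ≠ 1) :
    qPochInf q a ≠ 0 := by
  have := tprod_one_add_ne_zero_of_summable (f := fun k : ℕ => -(a * q ^ k))
    (fun k => by rw [← sub_eq_add_neg]; exact sub_ne_zero.2 (h k).symm)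
    (summable_norm_mul_pow hq a)
  simpa only [qPochInf, sub_eq_add_neg] using this

theorem mul_pow_ne_one_of_qPochInf_ne_zero (hq : ‖q‖ < 1) {a : ℂ} (h : qPochInf q a ≠ 0) (k : ℕ) :
    a * q ^ k ≠ 1 := by
  intro hk
  refine h ?_
  rw [qPochInf_eq_mul hq a (k + 1), qPoch_succ, hk]
  simp

theorem qPoch_ne_zero_of_qPochInf_ne_zero (hq : ‖q‖ < 1) {a : ℂ} (h : qPochInf q a ≠ 0) (n : ℕ) :
    qPoch q a n ≠ 0 :=
  qPoch_ne_zero fun k _ => mul_pow_ne_one_of_qPochInf_ne_zero hq h k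

theorem norm_mul_pow_le (hq : ‖q‖ < 1) (a : ℂ) (k : ℕ) : ‖a * q ^ k‖ ≤ ‖a‖ := by
  rw [norm_mul, norm_pow]
  exact mul_le_of_le_one_right (norm_nonneg _) (pow_le_one₀ (norm_nonneg _) hq.le)

theorem qPochInf_ne_zero_of_norm_lt_one (hq : ‖q‖ < 1) {a : ℂ} (ha : ‖a‖ < 1) :
    qPochInf q a ≠ 0 :=
  qPochInf_ne_zero hq fun k hk => by
    have := norm_mul_pow_le hq a k
    rw [hk, norm_one] at this
    linarith

@[simp] theorem qPochInf_zero (q : ℂ) : qPochInf q 0 = 1 := by simp [qPochInf]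

theorem tendsto_qPoch (hq : ‖q‖ < 1) (a : ℂ) :
    Tendsto (qPoch q a) atTop (𝓝 (qPochInf q a)) :=
  (multipliable_qPochInf hq a).tendsto_prod_tprod_nat

/-- On a set bounded by R the factors differ from 1 by at most R‖q‖^k, so the product converges
locally uniformly and the limit is entire. -/
theorem differentiable_qPochInf (hq : ‖q‖ < 1) : Differentiable ℂ (qPochInf q) := by
  have h : HasProdLocallyUniformlyOn (fun (k : ℕ) a => 1 + -(a * q ^ k))
      (fun a => ∏' k : ℕ, (1 + -(a * q ^ k))) Set.univ := by
    refine hasProdLocallyUniformlyOn_of_forall_compact isOpen_univ fun K _ hK => ?_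
    obtain ⟨R, hR⟩ := hK.isBounded.exists_norm_le
    refine Summable.hasProdUniformlyOn_nat_one_add (u := fun k => R * ‖q‖ ^ k) hK
      ((summable_geometric_of_lt_one (norm_nonneg _) hq).mul_left _)
      (.of_forall fun k a ha => ?_) fun k => by fun_prop
    rw [norm_neg, norm_mul, norm_pow]
    exact mul_le_mul_of_nonneg_right (hR a ha) (by positivity)
  have h2 := h.differentiableOn (.of_forall fun s => by fun_prop) isOpen_univ
  rw [differentiableOn_univ] at h2
  have e : qPochInf q = fun a => ∏' k : ℕ, (1 + -(a * q ^ k)) := by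
    funext a
    simp only [qPochInf, sub_eq_add_neg]
  rw [e]
  exact h2

theorem continuous_qPochInf (hq : ‖q‖ < 1) : Continuous (qPochInf q) :=
  (differentiable_qPochInf hq).continuous

theorem exists_norm_qPochInf_le (hq : ‖q‖ < 1) (R : ℝ) :
    ∃ C, 0 < C ∧ ∀ x : ℂ, ‖x‖ ≤ R → ‖qPochInf q x‖ ≤ C := by
  obtain ⟨C, hC⟩ := (isCompact_closedBall (0 : ℂ) R).exists_bound_of_continuousOn
    (continuous_qPochInf hq).continuousOn
  refine ⟨max C 1, by positivity, fun x hx => (hC x ?_).trans (le_max_left _ _)⟩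
  simpa using hx

theorem exists_norm_inv_qPoch_le (hq : ‖q‖ < 1) {K : Set ℂ} (hK : IsCompact K)
    (h : ∀ x ∈ K, qPochInf q x ≠ 0) :
    ∃ C, 0 < C ∧ ∀ x ∈ K, ‖(qPochInf q x)⁻¹‖ ≤ C ∧ ∀ n, ‖(qPoch q x n)⁻¹‖ ≤ C := by
  obtain ⟨C, hC⟩ := hK.exists_bound_of_continuousOn
    ((continuous_qPochInf hq).continuousOn.inv₀ h)
  obtain ⟨R, hR⟩ := hK.isBounded.exists_norm_le
  obtain ⟨D, hD0, hD⟩ := exists_norm_qPochInf_le hq R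
  refine ⟨max 1 C * max 1 D, by positivity, fun x hx => ⟨?_, fun n => ?_⟩⟩
  · refine ((hC x hx).trans (le_max_right 1 C)).trans (le_mul_of_one_le_right (by positivity) ?_)
    exact le_max_left _ _
  -- The tail (xq^n; q)_∞ has argument no larger than x, so one bound on the compact set handles all
  -- n.
  · have e : (qPoch q x n)⁻¹ = (qPochInf q x)⁻¹ * qPochInf q (x * q ^ n) := by
      have h1 := h x hx
      have h2 := qPochInf_eq_mul hq x n
      have h3 := qPoch_ne_zero_of_qPochInf_ne_zero hq h1 n
      field_simp
      rw [h2]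
    rw [e, norm_mul]
    exact mul_le_mul ((hC x hx).trans (le_max_right _ _))
      ((hD _ ((norm_mul_pow_le hq x n).trans (hR x hx))).trans (le_max_right _ _))
      (norm_nonneg _) (by positivity)

theorem exists_norm_qPoch_le (hq : ‖q‖ < 1) (x : ℂ) : ∃ C, 0 < C ∧ ∀ n, ‖qPoch q x n‖ ≤ C := by
  obtain ⟨C, hC⟩ := (tendsto_qPoch hq x).norm.bddAbove_range
  exact ⟨max C 1, by positivity, fun n => (hC ⟨n, rfl⟩).trans (le_max_left _ _)⟩

theorem exists_norm_inv_qPoch_le_of_ne_zero (hq : ‖q‖ < 1) {x : ℂ} (hx : qPochInf q x ≠ 0) :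
    ∃ C, 0 < C ∧ ∀ n, ‖(qPoch q x n)⁻¹‖ ≤ C := by
  obtain ⟨C, hC0, hC⟩ := exists_norm_inv_qPoch_le hq (isCompact_singleton (x := x))
    (by simpa using hx)
  exact ⟨C, hC0, (hC x rfl).2⟩

end qPochInf

/-- Each factor is at most 1 + |R|‖q‖^k, so everything is dominated by the convergent real product
(-|R|; ‖q‖)_n. -/
theorem exists_norm_qPoch_le_uniform {q : ℂ} (hq : ‖q‖ < 1) (R : ℝ) :
    ∃ C, 0 < C ∧ ∀ x : ℂ, ‖x‖ ≤ R → ∀ n, ‖qPoch q x n‖ ≤ C := by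
  have hq' : ‖((‖q‖ : ℝ) : ℂ)‖ < 1 := by simpa using hq
  obtain ⟨C, hC0, hC⟩ := exists_norm_qPoch_le hq' ((-|R| : ℝ) : ℂ)
  refine ⟨C, hC0, fun x hx n => le_trans ?_ (hC n)⟩
  rw [qPoch, qPoch, norm_prod, norm_prod]
  refine Finset.prod_le_prod (fun _ _ => norm_nonneg _) fun k _ => ?_
  have e : (1 : ℂ) - ((-|R| : ℝ) : ℂ) * ((‖q‖ : ℝ) : ℂ) ^ k = ((1 + |R| * ‖q‖ ^ k : ℝ) : ℂ) := by
    push_cast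
    ring
  rw [e, Complex.norm_real, Real.norm_of_nonneg (by positivity)]
  refine (norm_sub_le _ _).trans ?_
  rw [norm_one, norm_mul, norm_pow]
  have := hx.trans (le_abs_self R)
  gcongr

/-! ### The balanced series and their majorants. -/

/-- The coefficients of the balanced series in `w`. -/
noncomputable def branchCoeff (q a b c w : ℂ) (k : ℕ) : ℂ :=
  qPoch q (a * w⁻¹) k * qPoch q (b * w⁻¹) k * qPoch q (c * w⁻¹) k /
    (qPoch q q k * qPoch q (q * w⁻¹ ^ 2) k)

/-- The summand of `branchSeries`. -/
noncomputable def branchTerm (q a b c w x y v : ℂ) (k : ℕ) : ℂ :=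
  branchCoeff q a b c w k * q ^ k *
    (qPochInf q (x * q ^ k) * qPochInf q (y * q ^ k) / qPochInf q (v * q ^ k))

/-- One of the two balanced series, related by `w ↔ w⁻¹`, in the expansion of the `₈φ₇`. -/
noncomputable def branchSeries (q a b c w x y v : ℂ) : ℂ := ∑' k, branchTerm q a b c w x y v k

/-- A geometric majorant uniform in a, x, y, v, which serves summability, holomorphy and every
passage to the limit under the sum. Only v occurs in a denominator that varies, hence the radius ρ <
1. -/
theorem exists_norm_branchTerm_le {q : ℂ} (hq : ‖q‖ < 1) (b c : ℂ) {w : ℂ}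
    (hw : qPochInf q (q * w⁻¹ ^ 2) ≠ 0) (R : ℝ) {ρ : ℝ} (hρ : ρ < 1) :
    ∃ C, 0 < C ∧ ∀ a x y v : ℂ, ‖a‖ ≤ R → ‖x‖ ≤ R → ‖y‖ ≤ R → ‖v‖ ≤ ρ → ∀ k,
      ‖branchTerm q a b c w x y v k‖ ≤ C * ‖q‖ ^ k := by
  obtain ⟨A, hA0, hA⟩ := exists_norm_qPoch_le_uniform hq (R * ‖w⁻¹‖)
  obtain ⟨B, hB0, hB⟩ := exists_norm_qPoch_le hq (b * w⁻¹)
  obtain ⟨D, hD0, hD⟩ := exists_norm_qPoch_le hq (c * w⁻¹)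
  obtain ⟨E, hE0, hE⟩ := exists_norm_inv_qPoch_le_of_ne_zero hq
    (qPochInf_ne_zero_of_norm_lt_one hq hq)
  obtain ⟨F, hF0, hF⟩ := exists_norm_inv_qPoch_le_of_ne_zero hq hw
  obtain ⟨G, hG0, hG⟩ := exists_norm_qPochInf_le hq R
  obtain ⟨H, hH0, hH⟩ := exists_norm_inv_qPoch_le hq (isCompact_closedBall (0 : ℂ) ρ)
    fun x hx => qPochInf_ne_zero_of_norm_lt_one hq
      ((mem_closedBall_zero_iff.1 hx).trans_lt hρ)
  refine ⟨A * B * D * (E * F) * (G * G * H), by positivity, fun a x y v ha hx hy hv k => ?_⟩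
  rw [branchTerm, branchCoeff, div_eq_mul_inv _ (qPochInf q (v * q ^ k)), div_eq_mul_inv, mul_inv]
  simp only [norm_mul, norm_pow]
  rw [mul_right_comm _ (‖q‖ ^ k)]
  have h1 := hA (a * w⁻¹) (by rw [norm_mul]; gcongr) k
  have h2 := hB k
  have h3 := hD k
  have h4 := hE k
  have h5 := hF k
  have h6 := hG _ ((norm_mul_pow_le hq x k).trans hx)
  have h7 := hG _ ((norm_mul_pow_le hq y k).trans hy)
  have h8 := (hH (v * q ^ k)
    (mem_closedBall_zero_iff.2 ((norm_mul_pow_le hq v k).trans hv))).1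
  gcongr

theorem summable_geometric_const {q : ℂ} (hq : ‖q‖ < 1) (C : ℝ) :
    Summable fun k : ℕ => C * ‖q‖ ^ k :=
  (summable_geometric_of_lt_one (norm_nonneg _) hq).mul_left C

theorem summable_branchTerm {q : ℂ} (hq : ‖q‖ < 1) (a b c : ℂ) {w : ℂ}
    (hw : qPochInf q (q * w⁻¹ ^ 2) ≠ 0) (x y : ℂ) {v : ℂ} (hv : ‖v‖ < 1) :
    Summable (branchTerm q a b c w x y v) := by
  obtain ⟨C, -, hC⟩ := exists_norm_branchTerm_le hq b c hw (max ‖a‖ (max ‖x‖ ‖y‖)) hv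
  exact Summable.of_norm_bounded (summable_geometric_const hq C)
    (hC a x y v (by simp) (by simp) (by simp) le_rfl)

theorem differentiableOn_branchSeries {q : ℂ} (hq : ‖q‖ < 1) (a b c : ℂ) {w : ℂ}
    (hw : qPochInf q (q * w⁻¹ ^ 2) ≠ 0) {x y v : ℂ → ℂ} {U : Set ℂ} (hU : IsOpen U)
    (hx : Differentiable ℂ x) (hy : Differentiable ℂ y) (hv : Differentiable ℂ v) {R ρ : ℝ}
    (hρ : ρ < 1) (hxR : ∀ z ∈ U, ‖x z‖ ≤ R) (hyR : ∀ z ∈ U, ‖y z‖ ≤ R)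
    (hvρ : ∀ z ∈ U, ‖v z‖ ≤ ρ) :
    DifferentiableOn ℂ (fun z => branchSeries q a b c w (x z) (y z) (v z)) U := by
  obtain ⟨C, -, hC⟩ := exists_norm_branchTerm_le hq b c hw (max ‖a‖ R) hρ
  refine Complex.differentiableOn_tsum_of_summable_norm (summable_geometric_const hq C)
    (fun k => ?_) hU fun k z hz => hC a _ _ _ (le_max_left _ _)
      ((hxR z hz).trans (le_max_right _ _)) ((hyR z hz).trans (le_max_right _ _)) (hvρ z hz) k
  have hd := differentiable_qPochInf hq
  have h1 : Differentiable ℂ fun z => qPochInf q (x z * q ^ k) := hd.comp (hx.mul_const _)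
  have h2 : Differentiable ℂ fun z => qPochInf q (y z * q ^ k) := hd.comp (hy.mul_const _)
  have h3 : Differentiable ℂ fun z => qPochInf q (v z * q ^ k) := hd.comp (hv.mul_const _)
  refine DifferentiableOn.const_mul (DifferentiableOn.div (h1.mul h2).differentiableOn
    h3.differentiableOn fun z hz => ?_) _
  exact qPochInf_ne_zero_of_norm_lt_one hq
    (((norm_mul_pow_le hq _ k).trans (hvρ z hz)).trans_lt hρ)

/-! ### The nonterminating q-Saalschütz sum. -/

/-- The prefactor of `branchSeries`. -/
noncomputable def branchPre (q a b c w : ℂ) : ℂ :=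
  qPochInf q (a * w) * qPochInf q (b * w) * qPochInf q (c * w) / qPochInf q (w ^ 2)

/-- The sum of the two nonterminating balanced `₃φ₂`. -/
noncomputable def saalSeries (q a b c w : ℂ) : ℂ :=
  branchPre q a b c w * branchSeries q a b c w (a * b * c * w⁻¹) 0 0 +
    branchPre q a b c w⁻¹ * branchSeries q a b c w⁻¹ (a * b * c * w) 0 0

theorem branchTerm_zero_zero (q a b c w x : ℂ) (k : ℕ) :
    branchTerm q a b c w x 0 0 k = branchCoeff q a b c w k * q ^ k * qPochInf q (x * q ^ k) := by
  simp [branchTerm]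

/-- The telescoping antiderivative behind the recurrence of the nonterminating balanced `₃φ₂`. -/
noncomputable def saalAnti (q a b c w : ℂ) (n : ℕ) : ℂ :=
  -(a * w * qPochInf q (a * q * w) * branchCoeff q (a * q) b c w n * (1 - b * w⁻¹ * q ^ n) *
    (1 - c * w⁻¹ * q ^ n) * qPochInf q (a * b * c * w⁻¹ * q * q ^ n))

/-- A contiguous relation for a → aq, again with an explicit antiderivative in the summation index.
-/
theorem sum_branchTerm_sub {q : ℂ} (hq : ‖q‖ < 1) (a b c : ℂ) {w : ℂ} (hw0 : w ≠ 0)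
    (hw : qPochInf q (q * w⁻¹ ^ 2) ≠ 0) (n : ℕ) :
    ∑ k ∈ Finset.range (n + 1), (qPochInf q (a * w) *
          branchTerm q a b c w (a * b * c * w⁻¹) 0 0 k -
        (1 - a * b) * (1 - a * c) * (qPochInf q (a * q * w) *
          branchTerm q (a * q) b c w (a * q * b * c * w⁻¹) 0 0 k)) =
      saalAnti q a b c w n := by
  have e0 : qPochInf q (a * w) = (1 - a * w) * qPochInf q (a * q * w) := by
    rw [qPochInf_eq_mul_one hq, mul_right_comm]
  have hx : a * q * b * c * w⁻¹ = a * b * c * w⁻¹ * q := by ring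
  refine sum_range_eq_of_telescope _ _ n ?_ fun k _ => ?_
  · simp only [branchTerm_zero_zero, saalAnti, branchCoeff, qPoch_zero, pow_zero, mul_one, div_one,
      one_mul, hx]
    rw [e0, qPochInf_eq_mul_one hq (a * b * c * w⁻¹)]
    generalize qPochInf q (a * b * c * w⁻¹ * q) = F
    generalize qPochInf q (a * q * w) = E
    field_simp
    ring
  · have h1 : 1 - q * q ^ k ≠ 0 := sub_ne_zero.2 (mul_pow_ne_one_of_qPochInf_ne_zero hq
      (qPochInf_ne_zero_of_norm_lt_one hq hq) k).symm
    have h2 : 1 - q * w⁻¹ ^ 2 * q ^ k ≠ 0 :=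
      sub_ne_zero.2 (mul_pow_ne_one_of_qPochInf_ne_zero hq hw k).symm
    have h3 := qPoch_ne_zero_of_qPochInf_ne_zero hq (qPochInf_ne_zero_of_norm_lt_one hq hq) k
    have h4 := qPoch_ne_zero_of_qPochInf_ne_zero hq hw k
    have e1 : a * q * w⁻¹ = a * w⁻¹ * q := by ring
    have e2 : qPochInf q (a * b * c * w⁻¹ * q ^ (k + 1)) =
        (1 - a * b * c * w⁻¹ * q * q ^ k) * qPochInf q (a * b * c * w⁻¹ * q * q ^ (k + 1)) := by
      rw [qPochInf_eq_mul_one hq]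
      congr 2 <;> ring
    have e3 : qPochInf q (a * b * c * w⁻¹ * q * q ^ k) =
        (1 - a * b * c * w⁻¹ * q * q ^ k) * qPochInf q (a * b * c * w⁻¹ * q * q ^ (k + 1)) := by
      rw [qPochInf_eq_mul_one hq]
      congr 2 ; ring
    simp only [branchTerm_zero_zero, saalAnti, branchCoeff, hx, e1]
    rw [e2, e3, e0]
    generalize qPochInf q (a * b * c * w⁻¹ * q * q ^ (k + 1)) = F
    generalize qPochInf q (a * q * w) = E
    rw [qPoch_succ_left q (a * w⁻¹), qPoch_succ q (a * w⁻¹ * q), qPoch_succ q (b * w⁻¹),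
      qPoch_succ q (c * w⁻¹), qPoch_succ q q, qPoch_succ q (q * w⁻¹ ^ 2)]
    generalize qPoch q (a * w⁻¹ * q) k = X1 at *
    generalize qPoch q (b * w⁻¹) k = X2 at *
    generalize qPoch q (c * w⁻¹) k = X3 at *
    generalize qPoch q q k = X4 at *
    generalize qPoch q (q * w⁻¹ ^ 2) k = X5 at *
    rw [pow_succ q k]
    generalize q ^ k = x at *
    clear e1 e2 e3 hx e0 hw
    have hv0 := inv_ne_zero hw0
    obtain ⟨v, rfl⟩ : ∃ v, w = v⁻¹ := ⟨w⁻¹, (inv_inv w).symm⟩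
    rw [inv_inv] at *
    generalize hu1 : 1 - q * x = u1 at *
    generalize hu2 : 1 - q * v ^ 2 * x = u2 at *
    field_simp
    subst hu1 hu2
    ring

theorem tendsto_const_mul_pow {q : ℂ} (hq : ‖q‖ < 1) (x : ℂ) :
    Tendsto (fun k : ℕ => x * q ^ k) atTop (𝓝 0) := by
  simpa using (tendsto_pow_atTop_nhds_zero_of_norm_lt_one hq).const_mul x

theorem tendsto_branchCoeff {q : ℂ} (hq : ‖q‖ < 1) (a b c : ℂ) {w : ℂ}
    (hw : qPochInf q (q * w⁻¹ ^ 2) ≠ 0) :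
    Tendsto (branchCoeff q a b c w) atTop
      (𝓝 (qPochInf q (a * w⁻¹) * qPochInf q (b * w⁻¹) * qPochInf q (c * w⁻¹) /
        (qPochInf q q * qPochInf q (q * w⁻¹ ^ 2)))) :=
  (((tendsto_qPoch hq _).mul (tendsto_qPoch hq _)).mul (tendsto_qPoch hq _)).div
    ((tendsto_qPoch hq _).mul (tendsto_qPoch hq _))
    (mul_ne_zero (qPochInf_ne_zero_of_norm_lt_one hq hq) hw)

/-- Limit of the telescoped sum. The boundary term at infinity does not vanish, so a single branch
satisfies only an inhomogeneous recurrence. -/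
theorem branchSeries_sub {q : ℂ} (hq : ‖q‖ < 1) (a b c : ℂ) {w : ℂ} (hw0 : w ≠ 0)
    (hw : qPochInf q (q * w⁻¹ ^ 2) ≠ 0) :
    qPochInf q (a * w) * branchSeries q a b c w (a * b * c * w⁻¹) 0 0 -
        (1 - a * b) * (1 - a * c) * (qPochInf q (a * q * w) *
          branchSeries q (a * q) b c w (a * q * b * c * w⁻¹) 0 0) =
      -(a * w * qPochInf q (a * q * w) * (qPochInf q (a * q * w⁻¹) * qPochInf q (b * w⁻¹) *
        qPochInf q (c * w⁻¹) / (qPochInf q q * qPochInf q (q * w⁻¹ ^ 2)))) := by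
  have s1 := (summable_branchTerm hq a b c hw (a * b * c * w⁻¹) 0 (v := 0) (by simp)).hasSum.mul_left
    (qPochInf q (a * w))
  have s2 := ((summable_branchTerm hq (a * q) b c hw (a * q * b * c * w⁻¹) 0 (v := 0)
    (by simp)).hasSum.mul_left (qPochInf q (a * q * w))).mul_left ((1 - a * b) * (1 - a * c))
  have s3 := ((s1.sub s2).tendsto_sum_nat.comp (tendsto_add_atTop_nat 1))
  refine tendsto_nhds_unique (s3.congr fun n => sum_branchTerm_sub hq a b c hw0 hw n) ?_
  have t1 := tendsto_branchCoeff hq (a * q) b c hw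
  have t2 := (tendsto_const_mul_pow hq (b * w⁻¹)).const_sub 1
  have t3 := (tendsto_const_mul_pow hq (c * w⁻¹)).const_sub 1
  have t4 := ((continuous_qPochInf hq).tendsto 0).comp
    (tendsto_const_mul_pow hq (a * b * c * w⁻¹ * q))
  have := (((((t1.const_mul (a * w * qPochInf q (a * q * w))).mul t2).mul t3).mul t4)).neg
  refine Tendsto.congr (fun n => ?_) (this.trans_eq (by simp))
  simp [saalAnti]

/-- `w, w⁻¹` are both admissible for `branchSeries` and `branchPre`. -/
structure Admissible (q w : ℂ) : Prop where
  ne_zero : w ≠ 0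
  sq_ne_one : w ^ 2 ≠ 1
  fst : qPochInf q (q * w ^ 2) ≠ 0
  snd : qPochInf q (q * w⁻¹ ^ 2) ≠ 0

theorem Admissible.inv {q w : ℂ} (h : Admissible q w) : Admissible q w⁻¹ where
  ne_zero := inv_ne_zero h.ne_zero
  sq_ne_one := by rw [inv_pow]; exact fun e => h.sq_ne_one (inv_eq_one.1 e)
  fst := h.snd
  snd := by rw [inv_inv]; exact h.fst

theorem Admissible.qPochInf_sq {q w : ℂ} (hq : ‖q‖ < 1) (h : Admissible q w) :
    qPochInf q (w ^ 2) ≠ 0 := by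
  rw [qPochInf_eq_mul_one hq, mul_comm _ q]
  exact mul_ne_zero (sub_ne_zero.2 h.sq_ne_one.symm) h.fst

/-- With the prefactors included, the inhomogeneous terms of the two branches agree up to w/(1 -
w²), which is odd under w ↔ w⁻¹; they cancel in the sum. -/
theorem saalSeries_recurrence {q : ℂ} (hq : ‖q‖ < 1) (a b c : ℂ) {w : ℂ} (h : Admissible q w) :
    saalSeries q a b c w = (1 - a * b) * (1 - a * c) * saalSeries q (a * q) b c w := by
  have h1 := branchSeries_sub hq a b c h.ne_zero h.snd
  have h2 := branchSeries_sub hq a b c h.inv.ne_zero h.inv.snd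
  rw [inv_inv] at h2
  have e1 : qPochInf q (w ^ 2) = (1 - w ^ 2) * qPochInf q (q * w ^ 2) := by
    rw [qPochInf_eq_mul_one hq, mul_comm _ q]
  have e2 : qPochInf q (w⁻¹ ^ 2) = (1 - w⁻¹ ^ 2) * qPochInf q (q * w⁻¹ ^ 2) := by
    rw [qPochInf_eq_mul_one hq, mul_comm _ q]
  have n1 := h.fst
  have n2 := h.snd
  have n3 : 1 - w ^ 2 ≠ 0 := sub_ne_zero.2 h.sq_ne_one.symm
  have n4 : 1 - w⁻¹ ^ 2 ≠ 0 := sub_ne_zero.2 h.inv.sq_ne_one.symm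
  have n5 := qPochInf_ne_zero_of_norm_lt_one hq hq
  have n6 := h.ne_zero
  simp only [saalSeries, branchPre, e1, e2]
  rw [sub_eq_iff_eq_add] at h1 h2
  have key : w / (1 - w ^ 2) + w⁻¹ / (1 - w⁻¹ ^ 2) = 0 := by
    have : w ^ 2 - 1 ≠ 0 := sub_ne_zero.2 h.sq_ne_one
    have e : 1 - w⁻¹ ^ 2 = (w ^ 2 - 1) / w ^ 2 := by field_simp
    rw [e, ← neg_sub (w ^ 2) 1]
    field_simp
    ring
  generalize 1 - w ^ 2 = z1 at *
  generalize 1 - w⁻¹ ^ 2 = z2 at *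
  linear_combination (qPochInf q (b * w) * qPochInf q (c * w) /
      (z1 * qPochInf q (q * w ^ 2))) * h1 +
    (qPochInf q (b * w⁻¹) * qPochInf q (c * w⁻¹) /
      (z2 * qPochInf q (q * w⁻¹ ^ 2))) * h2 -
    (a * qPochInf q (a * q * w) * qPochInf q (a * q * w⁻¹) * qPochInf q (b * w) *
      qPochInf q (b * w⁻¹) * qPochInf q (c * w) * qPochInf q (c * w⁻¹) /
      (qPochInf q q * qPochInf q (q * w ^ 2) * qPochInf q (q * w⁻¹ ^ 2))) * key

theorem saalSeries_eq_qPoch_mul {q : ℂ} (hq : ‖q‖ < 1) (a b c : ℂ) {w : ℂ} (h : Admissible q w)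
    (n : ℕ) :
    saalSeries q a b c w =
      qPoch q (a * b) n * qPoch q (a * c) n * saalSeries q (a * q ^ n) b c w := by
  induction n with
  | zero => simp
  | succ n ih =>
    rw [ih, saalSeries_recurrence hq _ b c h, qPoch_succ, qPoch_succ, pow_succ, ← mul_assoc]
    ring_nf

theorem tendsto_branchSeries_saal {q : ℂ} (hq : ‖q‖ < 1) (a b c : ℂ) {w : ℂ}
    (hw : qPochInf q (q * w⁻¹ ^ 2) ≠ 0) :
    Tendsto (fun n : ℕ => branchSeries q (a * q ^ n) b c w (a * q ^ n * b * c * w⁻¹) 0 0) atTop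
      (𝓝 (branchSeries q 0 b c w 0 0 0)) := by
  obtain ⟨C, -, hC⟩ := exists_norm_branchTerm_le hq b c hw
    (max ‖a‖ (‖a‖ * ‖b * c * w⁻¹‖)) (ρ := 0) (by norm_num)
  refine tendsto_tsum_of_dominated_convergence (summable_geometric_const hq C) (fun k => ?_)
    (.of_forall fun n k => ?_)
  · have hc := continuous_qPochInf hq
    have h1 : Continuous fun x => qPoch q x k := by
      unfold qPoch
      fun_prop
    have h2 : Continuous fun a => branchTerm q a b c w (a * b * c * w⁻¹) 0 0 k := by
      simp only [branchTerm_zero_zero, branchCoeff]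
      refine ((Continuous.div_const (((h1.comp (continuous_mul_const _)).mul_const _).mul_const _)
        _).mul_const _).mul (hc.comp (by fun_prop))
    simpa [Function.comp_def] using (h2.tendsto 0).comp (tendsto_const_mul_pow hq a)
  · have h1 := norm_mul_pow_le hq a n
    refine hC _ _ _ _ (h1.trans (le_max_left _ _)) ?_ (by simp) (by simp) k
    rw [show a * q ^ n * b * c * w⁻¹ = a * q ^ n * (b * c * w⁻¹) by ring, norm_mul]
    exact (mul_le_mul_of_nonneg_right h1 (norm_nonneg _)).trans (le_max_right _ _)

/-- Iterate the recurrence and let aq^n → 0: the dependence on a is now confined to two explicit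
products. -/
theorem saalSeries_eq_zero_param {q : ℂ} (hq : ‖q‖ < 1) (a b c : ℂ) {w : ℂ} (h : Admissible q w) :
    saalSeries q a b c w = qPochInf q (a * b) * qPochInf q (a * c) * saalSeries q 0 b c w := by
  have t0 := tendsto_branchSeries_saal hq a b c h.snd
  have t1 := tendsto_branchSeries_saal hq a b c h.inv.snd
  rw [inv_inv] at t1
  have t2 : Tendsto (fun n : ℕ => qPochInf q (a * q ^ n * w)) atTop (𝓝 1) := by
    have := ((continuous_qPochInf hq).tendsto 0).comp
      ((tendsto_const_mul_pow hq a).mul_const w |>.trans_eq (by simp))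
    simpa [Function.comp_def] using this
  have t3 : Tendsto (fun n : ℕ => qPochInf q (a * q ^ n * w⁻¹)) atTop (𝓝 1) := by
    have := ((continuous_qPochInf hq).tendsto 0).comp
      ((tendsto_const_mul_pow hq a).mul_const w⁻¹ |>.trans_eq (by simp))
    simpa [Function.comp_def] using this
  have t4 : Tendsto (fun n : ℕ => saalSeries q (a * q ^ n) b c w) atTop
      (𝓝 (saalSeries q 0 b c w)) := by
    have := ((((t2.mul_const (qPochInf q (b * w))).mul_const (qPochInf q (c * w))).div_const
      (qPochInf q (w ^ 2))).mul t0).add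
      ((((t3.mul_const (qPochInf q (b * w⁻¹))).mul_const (qPochInf q (c * w⁻¹))).div_const
      (qPochInf q (w⁻¹ ^ 2))).mul t1)
    simpa [saalSeries, branchPre] using this
  refine tendsto_nhds_unique (tendsto_const_nhds.congr fun n =>
    saalSeries_eq_qPoch_mul hq a b c h n) (((tendsto_qPoch hq _).mul (tendsto_qPoch hq _)).mul t4)

/-- At a = w⁻¹ the prefactor of the first branch contains (1; q)_∞ = 0, and the second series
contains (1; q)_k, which leaves only k = 0. -/
theorem saalSeries_inv {q : ℂ} (hq : ‖q‖ < 1) (b c : ℂ) {w : ℂ} (h : Admissible q w) :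
    saalSeries q w⁻¹ b c w = qPochInf q (w⁻¹ * b) * qPochInf q (w⁻¹ * c) * qPochInf q (b * c) := by
  have hw0 := h.ne_zero
  have e1 : qPochInf q (w⁻¹ * w) = 0 := by
    rw [inv_mul_cancel₀ hw0, qPochInf_eq_mul_one hq]
    simp
  have e2 : branchSeries q w⁻¹ b c w⁻¹ (w⁻¹ * b * c * w) 0 0 = qPochInf q (b * c) := by
    rw [branchSeries, tsum_eq_single 0]
    · simp only [branchTerm_zero_zero, branchCoeff, qPoch_zero, pow_zero]
      rw [show w⁻¹ * b * c * w * 1 = b * c by field_simp]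
      simp
    · intro k hk
      obtain ⟨m, rfl⟩ := Nat.exists_eq_succ_of_ne_zero hk
      simp [branchTerm, branchCoeff, qPoch_succ_left, hw0]
  have n := h.inv.qPochInf_sq hq
  rw [saalSeries, branchPre, branchPre, e1, e2]
  rw [← pow_two, zero_mul, zero_mul, zero_div, zero_mul, zero_add, mul_comm b, mul_comm c]
  generalize qPochInf q (w⁻¹ ^ 2) = z at *
  field_simp

/-- The nonterminating `q`-Pfaff–Saalschütz summation. -/
theorem saalSeries_eq {q : ℂ} (hq : ‖q‖ < 1) (a : ℂ) {b c : ℂ} {w : ℂ} (h : Admissible q w)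
    (hb : qPochInf q (w⁻¹ * b) ≠ 0) (hc : qPochInf q (w⁻¹ * c) ≠ 0) :
    saalSeries q a b c w = qPochInf q (a * b) * qPochInf q (a * c) * qPochInf q (b * c) := by
  -- Comparing with the special value a = w⁻¹ determines the remaining constant as (bc; q)_∞; `hb`
  -- and `hc` allow the division.
  have h1 := saalSeries_inv hq b c h
  rw [saalSeries_eq_zero_param hq _ _ _ h] at h1
  rw [saalSeries_eq_zero_param hq _ _ _ h, mul_left_cancel₀ (mul_ne_zero hb hc) h1]

/-! ### The two-term expansion at ε = q^N. -/

/-- Standing assumptions on `q`, `a`, `b`, `c` and `w = e^{iθ}`. -/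
structure Params (q a b c w : ℂ) : Prop where
  q_lt : ‖q‖ < 1
  q_ne : q ≠ 0
  a_ne : a ≠ 0
  b_ne : b ≠ 0
  c_ne : c ≠ 0
  a_lt : ‖a‖ < 1
  b_lt : ‖b‖ < 1
  c_lt : ‖c‖ < 1
  norm_w : ‖w‖ = 1
  w_sq : w ^ 2 ≠ 1

namespace Params

variable {q a b c w : ℂ}

theorem w_ne (h : Params q a b c w) : w ≠ 0 := by
  rw [← norm_ne_zero_iff, h.norm_w]
  exact one_ne_zero

theorem admissible (h : Params q a b c w) : Admissible q w where
  ne_zero := h.w_ne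
  sq_ne_one := h.w_sq
  fst := qPochInf_ne_zero_of_norm_lt_one h.q_lt (by simpa [h.norm_w] using h.q_lt)
  snd := qPochInf_ne_zero_of_norm_lt_one h.q_lt (by simpa [h.norm_w] using h.q_lt)

theorem inv (h : Params q a b c w) : Params q a b c w⁻¹ :=
  { h with
    norm_w := by rw [norm_inv, h.norm_w, inv_one]
    w_sq := h.admissible.inv.sq_ne_one }

theorem mul_lt {x y : ℂ} (hx : ‖x‖ < 1) (hy : ‖y‖ < 1) : ‖x * y‖ < 1 := by
  rw [norm_mul]
  exact mul_lt_one_of_nonneg_of_lt_one_left (norm_nonneg _) hx hy.le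

theorem qPoch_q_ne (h : Params q a b c w) (n : ℕ) : qPoch q q n ≠ 0 :=
  qPoch_ne_zero_of_qPochInf_ne_zero h.q_lt (qPochInf_ne_zero_of_norm_lt_one h.q_lt h.q_lt) n

theorem ab_ne (h : Params q a b c w) : qPochInf q (a * b) ≠ 0 :=
  qPochInf_ne_zero_of_norm_lt_one h.q_lt (mul_lt h.a_lt h.b_lt)

theorem ac_ne (h : Params q a b c w) : qPochInf q (a * c) ≠ 0 :=
  qPochInf_ne_zero_of_norm_lt_one h.q_lt (mul_lt h.a_lt h.c_lt)

theorem bc_ne (h : Params q a b c w) : qPochInf q (b * c) ≠ 0 :=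
  qPochInf_ne_zero_of_norm_lt_one h.q_lt (mul_lt h.b_lt h.c_lt)

theorem saalSeries_eq (h : Params q a b c w) (x : ℂ) :
    saalSeries q x b c w = qPochInf q (x * b) * qPochInf q (x * c) * qPochInf q (b * c) :=
  _root_.saalSeries_eq h.q_lt x h.admissible
    (qPochInf_ne_zero_of_norm_lt_one h.q_lt (by simpa [h.norm_w] using h.b_lt))
    (qPochInf_ne_zero_of_norm_lt_one h.q_lt (by simpa [h.norm_w] using h.c_lt))

end Params

/-- The parameter `s = q^{-ν} / d` avoids the removable singularities. -/
structure GenericShift (q a w s : ℂ) : Prop where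
  ne_zero : s ≠ 0
  a_ne : ∀ n : ℕ, a * s * q ^ n ≠ 1
  w_ne : qPochInf q (q * s * w) ≠ 0
  w_inv_ne : qPochInf q (q * s * w⁻¹) ≠ 0

theorem GenericShift.inv {q a w s : ℂ} (h : GenericShift q a w s) : GenericShift q a w⁻¹ s :=
  { h with
    w_ne := h.w_inv_ne
    w_inv_ne := by rw [inv_inv]; exact h.w_ne }

/-- The two-term expansion of `(ab, ac, bc; q)_∞ u_ν`, with `s = q^{-ν} / d` and `ε = q^ν`. -/
noncomputable def expansion (q a b c w s ε : ℂ) : ℂ :=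
  branchPre q a b c w *
      branchSeries q a b c w (a * b * c * ε * w⁻¹) (q * s * w⁻¹) (q * s * ε * w⁻¹) +
    branchPre q a b c w⁻¹ *
      branchSeries q a b c w⁻¹ (a * b * c * ε * w) (q * s * w) (q * s * ε * w)

/-- The coefficients of the `₄φ₃` at `ε = q^N`. -/
noncomputable def finiteCoeff (q e y : ℂ) (N j : ℕ) : ℂ :=
  qPoch q q N * (qPoch q y j * qPoch q e (N - j) * e ^ j / (qPoch q q j * qPoch q q (N - j)))

/-- At ε = q^N the quotient of infinite products in s collapses to a finite factorial, which times
(bc; q)_N is the right-hand side of a terminating Saalschütz sum. Expanding it, each summand merges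
with the coefficients into a term with a replaced by aq^j and no s left. -/
theorem branchTerm_pow {q a b c w s : ℂ} (h : Params q a b c w) (hs : s ≠ 0)
    (hsw : qPochInf q (q * s * w⁻¹) ≠ 0) (N k : ℕ) :
    qPoch q (b * c) N * branchTerm q a b c w (a * b * c * q ^ N * w⁻¹) (q * s * w⁻¹)
        (q * s * q ^ N * w⁻¹) k =
      ∑ j ∈ Finset.range (N + 1), finiteCoeff q (q * s / a) (a * b * c / (q * s)) N j *
        (qPoch q (a * w⁻¹) j *
          branchTerm q (a * q ^ j) b c w (a * q ^ j * b * c * w⁻¹) 0 0 k) := by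
  have hq0 := h.q_ne
  have ha0 := h.a_ne
  have hS := sum_saalTerm h.qPoch_q_ne (a * w⁻¹ * q ^ k) (a * b * c / (q * s)) (q * s / a) N
  rw [show a * b * c / (q * s) * (q * s / a) = b * c by field_simp,
    show a * w⁻¹ * q ^ k * (q * s / a) = q * s * w⁻¹ * q ^ k by field_simp] at hS
  have e1 : qPochInf q (q * s * w⁻¹ * q ^ k) =
      qPoch q (q * s * w⁻¹ * q ^ k) N * qPochInf q (q * s * q ^ N * w⁻¹ * q ^ k) := by
    rw [qPochInf_eq_mul h.q_lt _ N]
    congr 2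
    ring
  have e2 : qPochInf q (q * s * q ^ N * w⁻¹ * q ^ k) ≠ 0 := by
    rw [qPochInf_eq_mul h.q_lt _ (k + N)] at hsw
    rw [show q * s * q ^ N * w⁻¹ * q ^ k = q * s * w⁻¹ * q ^ (k + N) by ring]
    exact right_ne_zero_of_mul hsw
  have e3 : qPoch q (b * c) N * qPoch q (q * s * w⁻¹ * q ^ k) N = qPoch q q N *
      ∑ j ∈ Finset.range (N + 1),
        saalTerm q (a * w⁻¹ * q ^ k) (a * b * c / (q * s)) (q * s / a) N j := by
    have := h.qPoch_q_ne N
    rw [hS]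
    field_simp
  have e4 : qPoch q (b * c) N * branchTerm q a b c w (a * b * c * q ^ N * w⁻¹) (q * s * w⁻¹)
        (q * s * q ^ N * w⁻¹) k = (qPoch q (b * c) N * qPoch q (q * s * w⁻¹ * q ^ k) N) *
        (branchCoeff q a b c w k * q ^ k * qPochInf q (a * b * c * q ^ N * w⁻¹ * q ^ k)) := by
    rw [branchTerm, e1]
    generalize qPochInf q (q * s * q ^ N * w⁻¹ * q ^ k) = X at *
    generalize qPochInf q (a * b * c * q ^ N * w⁻¹ * q ^ k) = Y
    field_simp
  rw [e4, e3, mul_assoc, Finset.sum_mul, Finset.mul_sum]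
  refine Finset.sum_congr rfl fun j hj => ?_
  obtain ⟨r, rfl⟩ : ∃ r, N = j + r := ⟨N - j, by have := Finset.mem_range.1 hj; omega⟩
  have e5 : qPoch q (a * w⁻¹) j * qPoch q (a * q ^ j * w⁻¹) k =
      qPoch q (a * w⁻¹) k * qPoch q (a * w⁻¹ * q ^ k) j := by
    rw [← qPoch_add, add_comm k j, qPoch_add, mul_right_comm a]
  have e6 : qPochInf q (a * q ^ j * b * c * w⁻¹ * q ^ k) =
      qPoch q (a * w⁻¹ * q ^ k * (a * b * c / (q * s)) * (q * s / a) * q ^ j) r *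
        qPochInf q (a * b * c * q ^ (j + r) * w⁻¹ * q ^ k) := by
    rw [qPochInf_eq_mul h.q_lt _ r]
    congr 2
    · field_simp
    · rw [pow_add]; ring
  have e7 : qPoch q (a * w⁻¹) j * branchCoeff q (a * q ^ j) b c w k =
      qPoch q (a * w⁻¹ * q ^ k) j * branchCoeff q a b c w k := by
    simp only [branchCoeff]
    linear_combination (qPoch q (b * w⁻¹) k * qPoch q (c * w⁻¹) k /
      (qPoch q q k * qPoch q (q * w⁻¹ ^ 2) k)) * e5
  rw [branchTerm_zero_zero, e6, finiteCoeff, saalTerm, Nat.add_sub_cancel_left]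
  generalize qPoch q (a * w⁻¹ * q ^ k * (a * b * c / (q * s)) * (q * s / a) * q ^ j) r = X
  linear_combination -(qPoch q q (j + r) * (qPoch q (a * b * c / (q * s)) j *
    qPoch q (q * s / a) r * (q * s / a) ^ j / (qPoch q q j * qPoch q q r))) * q ^ k * X *
      qPochInf q (a * b * c * q ^ (j + r) * w⁻¹ * q ^ k) * e7

theorem branchSeries_pow {q a b c w s : ℂ} (h : Params q a b c w) (hs : s ≠ 0)
    (hsw : qPochInf q (q * s * w⁻¹) ≠ 0) (N : ℕ) :
    qPoch q (b * c) N * branchSeries q a b c w (a * b * c * q ^ N * w⁻¹) (q * s * w⁻¹)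
        (q * s * q ^ N * w⁻¹) =
      ∑ j ∈ Finset.range (N + 1), finiteCoeff q (q * s / a) (a * b * c / (q * s)) N j *
        (qPoch q (a * w⁻¹) j *
          branchSeries q (a * q ^ j) b c w (a * q ^ j * b * c * w⁻¹) 0 0) := by
  have hsum : ∀ j, Summable fun k => finiteCoeff q (q * s / a) (a * b * c / (q * s)) N j *
        (qPoch q (a * w⁻¹) j *
          branchTerm q (a * q ^ j) b c w (a * q ^ j * b * c * w⁻¹) 0 0 k) := fun j =>
    ((summable_branchTerm h.q_lt _ _ _ h.admissible.snd _ _ (by simp)).mul_left _).mul_left _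
  simp only [branchSeries, ← tsum_mul_left]
  rw [← Summable.tsum_finsetSum fun j _ => hsum j]
  exact tsum_congr fun k => branchTerm_pow h hs hsw N k

theorem branchPre_eq_mul {q : ℂ} (hq : ‖q‖ < 1) (a b c w : ℂ) (j : ℕ) :
    branchPre q a b c w = qPoch q (a * w) j * branchPre q (a * q ^ j) b c w := by
  rw [branchPre, qPochInf_eq_mul hq (a * w) j, branchPre, mul_right_comm a w]
  ring

theorem expansion_pow {q a b c w s : ℂ} (h : Params q a b c w) (hs : GenericShift q a w s)
    (N : ℕ) :
    qPoch q (b * c) N * expansion q a b c w s (q ^ N) =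
      ∑ j ∈ Finset.range (N + 1), finiteCoeff q (q * s / a) (a * b * c / (q * s)) N j *
        (qPoch q (a * w) j * qPoch q (a * w⁻¹) j * (qPochInf q (a * q ^ j * b) *
          qPochInf q (a * q ^ j * c) * qPochInf q (b * c))) := by
  have h1 := branchSeries_pow h hs.ne_zero hs.w_inv_ne N
  have h2 := branchSeries_pow h.inv hs.ne_zero hs.inv.w_inv_ne N
  rw [inv_inv] at h2
  rw [expansion, mul_add, mul_left_comm, h1, mul_left_comm, h2, Finset.mul_sum, Finset.mul_sum,
    ← Finset.sum_add_distrib]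
  refine Finset.sum_congr rfl fun j _ => ?_
  -- For each j the two branches with parameter aq^j add up by the nonterminating sum.
  rw [← h.saalSeries_eq, saalSeries, branchPre_eq_mul h.q_lt a b c w j,
    branchPre_eq_mul h.q_lt a b c w⁻¹ j]
  ring

/-! ### The very-well-poised series and the identity theorem in ε. -/

/-- The summand of the `₈φ₇`, with `s = q^{-ν} / d` and `ε = q^ν`. -/
noncomputable def wpTerm (q a b c w s ε : ℂ) (k : ℕ) : ℂ :=
  (1 - a * s * q ^ (2 * k)) / (1 - a * s) *
    (qPoch q (a * s) k * qPoch q (q * s / b) k * qPoch q (q * s / c) k * qPoch q (a * w) k *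
        qPoch q (a * w⁻¹) k /
      (qPoch q q k * qPoch q (a * b) k * qPoch q (a * c) k * qPoch q (q * s * w) k *
        qPoch q (q * s * w⁻¹) k)) *
    ((∏ j ∈ Finset.range k, (ε - q ^ j) * (b * c)) / qPoch q (a * q * s * ε) k)

/-- The `₈φ₇` expression for `u_ν`, with `s = q^{-ν} / d` and `ε = q^ν`. -/
noncomputable def wpSeries (q a b c w s ε : ℂ) : ℂ :=
  qPochInf q (a * q * s * ε) * qPochInf q (b * c * ε) * qPochInf q (q * s * w) *
      qPochInf q (q * s * w⁻¹) /
    (qPochInf q (a * q * s) * qPochInf q (b * c) * qPochInf q (q * s * ε * w) *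
      qPochInf q (q * s * ε * w⁻¹)) * ∑' k, wpTerm q a b c w s ε k

theorem prod_pow_sub_pow_of_lt (q x : ℂ) {N k : ℕ} (h : N < k) :
    ∏ j ∈ Finset.range k, (q ^ N - q ^ j) * x = 0 :=
  Finset.prod_eq_zero (Finset.mem_range.2 h) (by simp)

/-- This is (q^{-N}; q)_k written through (q; q)_N/(q; q)_{N-k}, with N = k + r. -/
theorem prod_pow_sub_pow (q x : ℂ) (k r : ℕ) :
    (∏ j ∈ Finset.range k, (q ^ (k + r) - q ^ j) * x) * qPoch q q r =
      (∏ j ∈ Finset.range k, -q ^ j) * x ^ k * qPoch q q (k + r) := by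
  induction k generalizing r with
  | zero => simp
  | succ k ih =>
    have h1 := ih (r + 1)
    rw [qPoch_succ] at h1
    rw [Finset.prod_range_succ, Finset.prod_range_succ, show k + 1 + r = k + (r + 1) by ring]
    have e : (q ^ (k + (r + 1)) - q ^ k) = -q ^ k * (1 - q * q ^ r) := by ring
    rw [e]
    linear_combination -q ^ k * x * h1

/-- The dictionary to Watson's transformation: A = as, e = qs/a, y = abc/(qs), B = qs/b, C = qs/c.
-/
theorem wpTerm_pow {q a b c w s : ℂ} (h : Params q a b c w) (hs : GenericShift q a w s)
    {N k : ℕ} (hk : k ≤ N) :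
    qPoch q (q * s * w) N * qPoch q (q * s * w⁻¹) N * wpTerm q a b c w s (q ^ N) k =
      qPoch q q N * qPoch q (a * q * s) N *
      (vwpCoeff q (a * b * c / (q * s)) (q * s / b) (q * s / c) k * (q * s / a) ^ k *
        (1 - a * s * q ^ (2 * k)) / (qPoch q q (N - k) * qPoch q (a * s * q ^ k) (N + 1)) *
        (qPoch q (a * w) k * qPoch q (a * w⁻¹) k) *
        (qPoch q (q * s * w * q ^ k) (N - k) * qPoch q (q * s * w⁻¹ * q ^ k) (N - k))) := by
  obtain ⟨r, rfl⟩ := Nat.exists_eq_add_of_le hk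
  have hq0 := h.q_ne
  have ha0 := h.a_ne
  have hb0 := h.b_ne
  have hc0 := h.c_ne
  have hs0 := hs.ne_zero
  have hA : ∀ m n, qPoch q (a * s * q ^ m) n ≠ 0 := fun m n => qPoch_ne_zero fun j _ => by
    rw [mul_assoc, ← pow_add]; exact hs.a_ne _
  have e1 := prod_pow_sub_pow q (b * c) k r
  have n1 := h.qPoch_q_ne r
  have n2 := h.qPoch_q_ne k
  have n3 := qPoch_ne_zero_of_qPochInf_ne_zero h.q_lt h.ab_ne k
  have n4 := qPoch_ne_zero_of_qPochInf_ne_zero h.q_lt h.ac_ne k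
  have n5 := qPoch_ne_zero_of_qPochInf_ne_zero h.q_lt hs.w_ne k
  have n6 := qPoch_ne_zero_of_qPochInf_ne_zero h.q_lt hs.w_inv_ne k
  have n7 : 1 - a * s ≠ 0 := sub_ne_zero.2 (by simpa using (hs.a_ne 0).symm)
  have n8 := hA k (k + r + 1)
  have n9 : qPoch q (a * q * s * q ^ (k + r)) k ≠ 0 := by
    have := hA (k + r + 1) k
    rwa [show a * s * q ^ (k + r + 1) = a * q * s * q ^ (k + r) by ring] at this
  have e2 : qPoch q (a * s) k * qPoch q (a * s * q ^ k) (k + r + 1) =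
      (1 - a * s) * qPoch q (a * q * s) (k + r) * qPoch q (a * q * s * q ^ (k + r)) k := by
    rw [← qPoch_add, mul_assoc, ← qPoch_add, mul_right_comm a q s, ← qPoch_succ_left]
    congr 1
    ring
  rw [← eq_div_iff n1] at e1
  rw [← eq_div_iff n8] at e2
  rw [wpTerm, e1, e2, vwpCoeff, Nat.add_sub_cancel_left, qPoch_add q (q * s * w),
    qPoch_add q (q * s * w⁻¹), show a * b * c / (q * s) * (q * s / c) = a * b by field_simp,
    show a * b * c / (q * s) * (q * s / b) = a * c by field_simp]
  have e3 : (b * c) ^ k = (a * b * c / (q * s)) ^ k * (q * s / a) ^ k := by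
    rw [← mul_pow]
    congr 1
    field_simp
  rw [e3]
  generalize (a * b * c / (q * s)) ^ k = Y
  generalize (q * s / a) ^ k = Z
  generalize qPoch q (a * q * s * q ^ (k + r)) k = X1 at *
  generalize qPoch q (a * s * q ^ k) (k + r + 1) = X2 at *
  generalize qPoch q (q * s * w) k = X3 at *
  generalize qPoch q (q * s * w⁻¹) k = X4 at *
  generalize qPoch q (q * s * w * q ^ k) r = X5 at *
  generalize qPoch q (q * s * w⁻¹ * q ^ k) r = X6 at *
  generalize qPoch q (q * s / b) k = X7 at *
  generalize qPoch q (q * s / c) k = X8 at *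
  generalize qPoch q (a * w⁻¹) k = X9 at *
  clear e1 e2 e3
  generalize 1 - a * s = u at *
  generalize 1 - a * s * q ^ (2 * k) = u' at *
  generalize qPoch q (a * w) k = X10
  generalize qPoch q (a * b) k = X11 at *
  generalize qPoch q (a * c) k = X12 at *
  generalize qPoch q (a * q * s) (k + r) = X13
  generalize qPoch q q (k + r) = X14
  generalize qPoch q q k = X15 at *
  generalize qPoch q q r = X16 at *
  generalize ∏ i ∈ Finset.range k, -q ^ i = X17
  clear * - n5 n6 n7 n9
  -- Only the four displayed pairs have to cancel; the other denominators match on both sides, so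
  -- `ring` can treat their inverses as formal.
  trans X14 * X13 * (X17 * Y * X7 * X8 / (X11 * X12 * X15) * Z * u' / (X16 * X2) * (X10 * X9) *
    (X5 * X6)) * ((u * u⁻¹) * (X1 * X1⁻¹) * (X3 * X3⁻¹) * (X4 * X4⁻¹))
  · ring
  · rw [mul_inv_cancel₀ n5, mul_inv_cancel₀ n6, mul_inv_cancel₀ n7, mul_inv_cancel₀ n9]
    ring

/-- Both sides reduce to the same `₄φ₃`, called `W` below: the left by Watson, the right by
`expansion_pow`. -/
theorem wpSeries_pow {q a b c w s : ℂ} (h : Params q a b c w) (hs : GenericShift q a w s)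
    (N : ℕ) :
    qPochInf q (a * b) * qPochInf q (a * c) * qPochInf q (b * c) * wpSeries q a b c w s (q ^ N) =
      expansion q a b c w s (q ^ N) := by
  have hq0 := h.q_ne
  have ha0 := h.a_ne
  have hb0 := h.b_ne
  have hc0 := h.c_ne
  have hs0 := hs.ne_zero
  have e1 : ∑' k, wpTerm q a b c w s (q ^ N) k =
      ∑ k ∈ Finset.range (N + 1), wpTerm q a b c w s (q ^ N) k :=
    tsum_eq_sum fun k hk => by
      rw [wpTerm, prod_pow_sub_pow_of_lt q _ (by simpa using hk), zero_div, mul_zero]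
  have e2 := watson_terminating (q := q) (a := a) (s := s) (e := q * s / a) (w := w)
    (A := a * s) (y := a * b * c / (q * s)) (B := q * s / b) (C := q * s / c)
    h.qPoch_q_ne h.w_ne ha0 (by field_simp) rfl hs.a_ne (by field_simp)
    (by
      rw [show a * b * c / (q * s) * (q * s / b) = a * c by field_simp]
      exact qPoch_ne_zero_of_qPochInf_ne_zero h.q_lt h.ac_ne)
    (by
      rw [show a * b * c / (q * s) * (q * s / c) = a * b by field_simp]
      exact qPoch_ne_zero_of_qPochInf_ne_zero h.q_lt h.ab_ne) N
  rw [show a * b * c / (q * s) * (q * s / c) = a * b by field_simp,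
    show a * b * c / (q * s) * (q * s / b) = a * c by field_simp] at e2
  obtain ⟨W, hW⟩ : ∃ W, W = ∑ j ∈ Finset.range (N + 1), qPoch q (a * b * c / (q * s)) j *
        qPoch q (q * s / a) (N - j) * (q * s / a) ^ j *
        (qPoch q (a * w) j * qPoch q (a * w⁻¹) j) /
        (qPoch q q j * qPoch q q (N - j) * qPoch q (a * b) j * qPoch q (a * c) j) := ⟨_, rfl⟩
  rw [← hW] at e2
  have e3 : qPoch q (q * s * w) N * qPoch q (q * s * w⁻¹) N *
      ∑ k ∈ Finset.range (N + 1), wpTerm q a b c w s (q ^ N) k =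
      qPoch q q N * qPoch q (a * q * s) N * W := by
    rw [← e2, Finset.mul_sum, Finset.mul_sum]
    exact Finset.sum_congr rfl fun k hk =>
      wpTerm_pow h hs (by have := Finset.mem_range.1 hk; omega)
  have e4 := expansion_pow h hs N
  have n1 := h.ab_ne
  have n2 := h.ac_ne
  have n3 := h.bc_ne
  have e5 : qPoch q (b * c) N * expansion q a b c w s (q ^ N) =
      qPochInf q (a * b) * qPochInf q (a * c) * qPochInf q (b * c) * (qPoch q q N * W) := by
    rw [e4, hW, Finset.mul_sum, Finset.mul_sum]
    refine Finset.sum_congr rfl fun j _ => ?_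
    have e6 := qPochInf_eq_mul h.q_lt (a * b) j
    have e7 := qPochInf_eq_mul h.q_lt (a * c) j
    have m1 := qPoch_ne_zero_of_qPochInf_ne_zero h.q_lt n1 j
    have m2 := qPoch_ne_zero_of_qPochInf_ne_zero h.q_lt n2 j
    rw [e6, e7, finiteCoeff, mul_right_comm a (q ^ j) b, mul_right_comm a (q ^ j) c]
    generalize qPoch q (a * b) j = X1 at *
    generalize qPoch q (a * c) j = X2 at *
    generalize qPoch q (a * w) j * qPoch q (a * w⁻¹) j = X3
    generalize qPochInf q (a * b * q ^ j) = X4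
    generalize qPochInf q (a * c * q ^ j) = X5
    generalize qPoch q (a * b * c / (q * s)) j * qPoch q (q * s / a) (N - j) * (q * s / a) ^ j = X6
    generalize qPoch q q j * qPoch q q (N - j) = X7
    generalize qPochInf q (b * c) = X8
    generalize qPoch q q N = X9
    clear * - m1 m2
    field_simp
  have f1 := qPochInf_eq_mul h.q_lt (a * q * s) N
  have f2 := qPochInf_eq_mul h.q_lt (b * c) N
  have f3 := qPochInf_eq_mul h.q_lt (q * s * w) N
  have f4 := qPochInf_eq_mul h.q_lt (q * s * w⁻¹) N
  have n4 : qPochInf q (a * q * s) ≠ 0 := qPochInf_ne_zero h.q_lt fun k => by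
    have := hs.a_ne (k + 1)
    rwa [show a * q * s * q ^ k = a * s * q ^ (k + 1) by ring]
  have n5 := hs.w_ne
  have n6 := hs.w_inv_ne
  have n7 := qPoch_ne_zero_of_qPochInf_ne_zero h.q_lt n3 N
  have n8 := qPoch_ne_zero_of_qPochInf_ne_zero h.q_lt n4 N
  have n9 := qPoch_ne_zero_of_qPochInf_ne_zero h.q_lt n5 N
  have n10 := qPoch_ne_zero_of_qPochInf_ne_zero h.q_lt n6 N
  have pre : qPochInf q (a * q * s * q ^ N) * qPochInf q (b * c * q ^ N) *
      qPochInf q (q * s * w) * qPochInf q (q * s * w⁻¹) / (qPochInf q (a * q * s) *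
      qPochInf q (b * c) * qPochInf q (q * s * q ^ N * w) * qPochInf q (q * s * q ^ N * w⁻¹)) =
      qPoch q (q * s * w) N * qPoch q (q * s * w⁻¹) N /
        (qPoch q (a * q * s) N * qPoch q (b * c) N) := by
    rw [mul_right_comm (q * s) (q ^ N), mul_right_comm (q * s) (q ^ N)]
    rw [div_eq_div_iff (mul_ne_zero (mul_ne_zero (mul_ne_zero n4 n3) ?_) ?_) (mul_ne_zero n8 n7),
      f1, f2, f3, f4]
    · ring
    · rw [f3] at n5
      exact right_ne_zero_of_mul n5
    · rw [f4] at n6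
      exact right_ne_zero_of_mul n6
  rw [← mul_right_inj' n7, e5, wpSeries, e1, pre]
  rw [mul_comm, ← eq_div_iff (mul_ne_zero n9 n10)] at e3
  rw [e3]
  clear e1 e2 e3 e4 e5 f1 f2 f3 f4 pre hW
  generalize qPoch q (q * s * w) N = X1 at *
  generalize qPoch q (q * s * w⁻¹) N = X2 at *
  generalize qPoch q (a * q * s) N = X3 at *
  generalize qPochInf q (a * b) * qPochInf q (a * c) * qPochInf q (b * c) = X4
  generalize qPoch q (b * c) N = X5 at *
  generalize qPoch q q N = X6
  clear * - n7 n8 n9 n10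
  field_simp

/-- The ratio of consecutive terms tends to xr < 1. With x = ‖bc‖ this is the majorant of the
very-well-poised series on ‖ε‖ ≤ r. -/
theorem summable_prod_const_add_pow {x r t : ℝ} (hx0 : 0 < x) (hr : 0 < r) (hxr : x * r < 1)
    (ht0 : 0 ≤ t) (ht : t < 1) :
    Summable fun k : ℕ => ∏ j ∈ Finset.range k, (r + t ^ j) * x := by
  have hpos : ∀ k : ℕ, 0 < ∏ j ∈ Finset.range k, (r + t ^ j) * x := fun k =>
    Finset.prod_pos fun j _ => by positivity
  refine summable_of_ratio_test_tendsto_lt_one hxr (.of_forall fun k => (hpos k).ne') ?_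
  have h : Tendsto (fun k : ℕ => (r + t ^ k) * x) atTop (𝓝 (x * r)) := by
    have := ((tendsto_pow_atTop_nhds_zero_of_lt_one ht0 ht).const_add r).mul_const x
    rwa [add_zero, mul_comm r] at this
  refine h.congr fun k => ?_
  rw [Real.norm_of_nonneg (hpos _).le, Real.norm_of_nonneg (hpos _).le, Finset.prod_range_succ,
    mul_div_cancel_left₀ _ (hpos k).ne']

theorem exists_norm_wpTerm_le {q a b c w s : ℂ} (h : Params q a b c w) (hs : GenericShift q a w s)
    (r : ℝ) {ρ : ℝ} (hρ : ρ < 1) :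
    ∃ C, ∀ ε : ℂ, ‖ε‖ ≤ r → ‖a * q * s * ε‖ ≤ ρ → ∀ k,
      ‖wpTerm q a b c w s ε k‖ ≤ C * ∏ j ∈ Finset.range k, (r + ‖q‖ ^ j) * ‖b * c‖ := by
  have hq := h.q_lt
  obtain ⟨C1, p1, h1⟩ := exists_norm_qPoch_le hq (a * s)
  obtain ⟨C2, p2, h2⟩ := exists_norm_qPoch_le hq (q * s / b)
  obtain ⟨C3, p3, h3⟩ := exists_norm_qPoch_le hq (q * s / c)
  obtain ⟨C4, p4, h4⟩ := exists_norm_qPoch_le hq (a * w)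
  obtain ⟨C5, p5, h5⟩ := exists_norm_qPoch_le hq (a * w⁻¹)
  obtain ⟨D1, d1, g1⟩ := exists_norm_inv_qPoch_le_of_ne_zero hq
    (qPochInf_ne_zero_of_norm_lt_one hq hq)
  obtain ⟨D2, d2, g2⟩ := exists_norm_inv_qPoch_le_of_ne_zero hq h.ab_ne
  obtain ⟨D3, d3, g3⟩ := exists_norm_inv_qPoch_le_of_ne_zero hq h.ac_ne
  obtain ⟨D4, d4, g4⟩ := exists_norm_inv_qPoch_le_of_ne_zero hq hs.w_ne
  obtain ⟨D5, d5, g5⟩ := exists_norm_inv_qPoch_le_of_ne_zero hq hs.w_inv_ne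
  obtain ⟨E, e0, hE⟩ := exists_norm_inv_qPoch_le hq (isCompact_closedBall (0 : ℂ) ρ)
    fun x hx => qPochInf_ne_zero_of_norm_lt_one hq ((mem_closedBall_zero_iff.1 hx).trans_lt hρ)
  refine ⟨(1 + ‖a * s‖) * ‖(1 - a * s)⁻¹‖ *
    (C1 * C2 * C3 * C4 * C5 * (D1 * D2 * D3 * D4 * D5)) * E, fun ε hε hε' k => ?_⟩
  have f0 : ‖1 - a * s * q ^ (2 * k)‖ ≤ 1 + ‖a * s‖ := by
    refine (norm_sub_le _ _).trans ?_
    rw [norm_one]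
    gcongr
    exact norm_mul_pow_le hq _ _
  have f1 := (hE (a * q * s * ε) (mem_closedBall_zero_iff.2 hε')).2 k
  have f2 : ‖∏ j ∈ Finset.range k, (ε - q ^ j) * (b * c)‖ ≤
      ∏ j ∈ Finset.range k, (r + ‖q‖ ^ j) * ‖b * c‖ := by
    rw [norm_prod]
    refine Finset.prod_le_prod (fun _ _ => norm_nonneg _) fun j _ => ?_
    rw [norm_mul]
    gcongr
    refine (norm_sub_le _ _).trans ?_
    rw [norm_pow]
    gcongr
  rw [wpTerm]
  simp only [div_eq_mul_inv, mul_inv, norm_mul] at *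
  have := h1 k
  have := h2 k
  have := h3 k
  have := h4 k
  have := h5 k
  have := g1 k
  have := g2 k
  have := g3 k
  have := g4 k
  have := g5 k
  rw [mul_assoc _ E, mul_comm E]
  gcongr
  exact (norm_nonneg _).trans f2

theorem differentiableOn_tsum_wpTerm {q a b c w s : ℂ} (h : Params q a b c w)
    (hs : GenericShift q a w s) {r ρ : ℝ} (hr : 0 < r) (hbc : ‖b * c‖ * r < 1) (hρ : ρ < 1)
    (hqs : ∀ ε ∈ Metric.ball (0 : ℂ) r, ‖a * q * s * ε‖ ≤ ρ) :
    DifferentiableOn ℂ (fun ε => ∑' k, wpTerm q a b c w s ε k) (Metric.ball 0 r) := by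
  obtain ⟨C, hC⟩ := exists_norm_wpTerm_le h hs r hρ
  refine Complex.differentiableOn_tsum_of_summable_norm
    ((summable_prod_const_add_pow (norm_pos_iff.2 (mul_ne_zero h.b_ne h.c_ne)) hr hbc
      (norm_nonneg q) h.q_lt).mul_left C) (fun k => ?_) Metric.isOpen_ball
    fun k ε hε => hC ε (mem_ball_zero_iff.1 hε).le (hqs ε hε) k
  unfold wpTerm
  refine DifferentiableOn.const_mul (DifferentiableOn.div ?_ ?_ fun ε hε => ?_) _
  · fun_prop
  · unfold qPoch
    fun_prop
  · exact qPoch_ne_zero_of_qPochInf_ne_zero h.q_lt (qPochInf_ne_zero_of_norm_lt_one h.q_lt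
      ((hqs ε hε).trans_lt hρ)) k

/-- The very-well-poised `₈φ₇` as a sum of two balanced `₄φ₃`. -/
theorem wpSeries_eq_expansion {q a b c w s ε : ℂ} (h : Params q a b c w)
    (hs : GenericShift q a w s) (h1 : ‖b * c * ε‖ < 1) (h2 : ‖q * s * ε‖ < 1) :
    qPochInf q (a * b) * qPochInf q (a * c) * qPochInf q (b * c) * wpSeries q a b c w s ε =
      expansion q a b c w s ε := by
  have hq := h.q_lt
  -- A radius r slightly above ‖ε‖ with mr < 1 keeps both bcz and qsz inside the unit disc, so every
  -- denominator in z stays nonzero on the ball.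
  set m := max ‖b * c‖ ‖q * s‖ with hm
  have hm0 : 0 < m := lt_max_of_lt_left (norm_pos_iff.2 (mul_ne_zero h.b_ne h.c_ne))
  obtain ⟨r, hr1, hr2⟩ : ∃ r, ‖ε‖ < r ∧ r < m⁻¹ := by
    refine exists_between ?_
    rw [← one_div, lt_div_iff₀ hm0, mul_comm, hm, max_mul_of_nonneg _ _ (norm_nonneg _),
      ← norm_mul, ← norm_mul]
    exact max_lt h1 h2
  have hr0 : 0 < r := (norm_nonneg _).trans_lt hr1
  have hmr : m * r < 1 := by
    rw [← one_div, lt_div_iff₀ hm0] at hr2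
    rwa [mul_comm]
  have b1 : ∀ z ∈ Metric.ball (0 : ℂ) r, ‖b * c * z‖ ≤ m * r := fun z hz => by
    rw [norm_mul]
    exact mul_le_mul (le_max_left _ _) (mem_ball_zero_iff.1 hz).le (norm_nonneg _) hm0.le
  have b2 : ∀ z ∈ Metric.ball (0 : ℂ) r, ‖q * s * z‖ ≤ m * r := fun z hz => by
    rw [norm_mul]
    exact mul_le_mul (le_max_right _ _) (mem_ball_zero_iff.1 hz).le (norm_nonneg _) hm0.le
  have b3 : ∀ z ∈ Metric.ball (0 : ℂ) r, ‖a * q * s * z‖ ≤ m * r := fun z hz => by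
    rw [show a * q * s * z = a * (q * s * z) by ring, norm_mul]
    exact (mul_le_of_le_one_left (norm_nonneg _) h.a_lt.le).trans (b2 z hz)
  have b4 : ∀ {v : ℂ}, ‖v‖ = 1 → ∀ z ∈ Metric.ball (0 : ℂ) r, ‖q * s * z * v‖ ≤ m * r :=
    fun {v} hv z hz => by
    rw [norm_mul, hv, mul_one]
    exact b2 z hz
  have b5 : ∀ {v : ℂ}, ‖v‖ = 1 → ∀ z ∈ Metric.ball (0 : ℂ) r, ‖a * b * c * z * v‖ ≤ 1 :=
    fun {v} hv z hz => by
    rw [norm_mul, hv, mul_one, show a * b * c * z = a * (b * c * z) by ring, norm_mul]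
    exact mul_le_one₀ h.a_lt.le (norm_nonneg _) ((b1 z hz).trans hmr.le)
  have nw' := h.inv.norm_w
  have nw := h.norm_w
  have hd := differentiable_qPochInf hq
  have hdl : ∀ x y : ℂ, Differentiable ℂ fun z : ℂ => qPochInf q (x * z * y) := fun x y =>
    hd.comp (by fun_prop)
  have hdl' : ∀ x : ℂ, Differentiable ℂ fun z : ℂ => qPochInf q (x * z) := fun x =>
    hd.comp (by fun_prop)
  have d1 : DifferentiableOn ℂ (fun z => qPochInf q (a * b) * qPochInf q (a * c) *
      qPochInf q (b * c) * wpSeries q a b c w s z) (Metric.ball 0 r) := by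
    unfold wpSeries
    refine DifferentiableOn.const_mul (DifferentiableOn.mul (DifferentiableOn.div
      ((((hdl' _).mul (hdl' _)).mul_const _).mul_const _).differentiableOn
      (((hdl _ _).const_mul _).mul (hdl _ _)).differentiableOn fun z hz => ?_)
      (differentiableOn_tsum_wpTerm h hs hr0
        ((mul_le_mul_of_nonneg_right (le_max_left _ _) hr0.le).trans_lt hmr) hmr b3)) _
    have n4 : qPochInf q (a * q * s) ≠ 0 := qPochInf_ne_zero hq fun k => by
      have := hs.a_ne (k + 1)
      rwa [show a * q * s * q ^ k = a * s * q ^ (k + 1) by ring]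
    exact mul_ne_zero (mul_ne_zero (mul_ne_zero n4 h.bc_ne)
      (qPochInf_ne_zero_of_norm_lt_one hq ((b4 nw z hz).trans_lt hmr)))
      (qPochInf_ne_zero_of_norm_lt_one hq ((b4 nw' z hz).trans_lt hmr))
  have d2 : DifferentiableOn ℂ (fun z => expansion q a b c w s z) (Metric.ball 0 r) := by
    unfold expansion
    refine ((differentiableOn_branchSeries hq a b c h.admissible.snd Metric.isOpen_ball
      (by fun_prop) (by fun_prop) (by fun_prop) (R := max 1 ‖q * s * w⁻¹‖) hmr
      (fun z hz => (b5 nw' z hz).trans (le_max_left _ _)) (fun _ _ => le_max_right _ _)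
      (b4 nw')).const_mul _).add ((differentiableOn_branchSeries hq a b c h.inv.admissible.snd
      Metric.isOpen_ball (by fun_prop) (by fun_prop) (by fun_prop) (R := max 1 ‖q * s * w‖) hmr
      (fun z hz => (b5 nw z hz).trans (le_max_left _ _)) (fun _ _ => le_max_right _ _)
      (b4 nw)).const_mul _)
  -- The points q^N lie in the punctured neighbourhoods of the centre 0, so agreement there forces
  -- agreement on the whole ball.
  refine (d1.analyticOnNhd Metric.isOpen_ball).eqOn_of_preconnected_of_frequently_eq
    (d2.analyticOnNhd Metric.isOpen_ball) (convex_ball _ _).isPreconnected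
    (Metric.mem_ball_self hr0) ?_ (mem_ball_zero_iff.2 hr1)
  have ht : Tendsto (fun N : ℕ => q ^ N) atTop (𝓝[≠] 0) :=
    tendsto_nhdsWithin_iff.2 ⟨tendsto_pow_atTop_nhds_zero_of_norm_lt_one hq,
      .of_forall fun N => pow_ne_zero _ h.q_ne⟩
  exact ht.frequently (.of_forall fun N => wpSeries_pow h hs N)

/-! ### From the definition of u_ν to the expansion. -/

/-- The four square-root factorials collapse to the rational factor (1 - r²q^{2k})/(1 - r²), so the
branch of the root is irrelevant. -/
theorem qPoch_very_well_poised (q r : ℂ) (k : ℕ) :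
    qPoch q (q * r) k * qPoch q (-(q * r)) k * (1 - r * r) =
      qPoch q r k * qPoch q (-r) k * (1 - r * r * q ^ (2 * k)) := by
  have h1 : (1 - r) * qPoch q (q * r) k = qPoch q r k * (1 - r * q ^ k) := by
    rw [← qPoch_succ, qPoch_succ_left, mul_comm r]
  have h2 : (1 - -r) * qPoch q (-(q * r)) k = qPoch q (-r) k * (1 - -r * q ^ k) := by
    rw [← qPoch_succ, qPoch_succ_left, ← neg_mul_eq_neg_mul, mul_comm r]
  have h3 := congrArg₂ (· * ·) h1 h2
  linear_combination h3

theorem uSeries_eq_wpSeries {q a b c w d μ : ℂ} (hq0 : q ≠ 0) (hd0 : d ≠ 0)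
    (hs : GenericShift q a w (q ^ (-μ) / d)) :
    uSeries q a b c d w μ = wpSeries q a b c w (q ^ (-μ) / d) (q ^ μ) := by
  have e1 : q ^ (1 - μ) = q * q ^ (-μ) := by
    rw [sub_eq_add_neg, Complex.cpow_add _ _ hq0, Complex.cpow_one]
  have e2 : q ^ μ = (q ^ (-μ))⁻¹ := by rw [Complex.cpow_neg, inv_inv]
  have hQ0 : q ^ (-μ) ≠ 0 := by
    intro h0
    exact hs.ne_zero (by rw [h0, zero_div])
  rw [uSeries, wpSeries, e1, e2]
  generalize q ^ (-μ) = Q at *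
  have hr : (a * Q / d) ^ (1 / 2 : ℂ) * (a * Q / d) ^ (1 / 2 : ℂ) = a * Q / d := by
    have := Complex.cpow_nat_inv_pow (a * Q / d) (n := 2) two_ne_zero
    rwa [pow_two, show (((2 : ℕ) : ℂ)⁻¹) = 1 / 2 by norm_num] at this
  generalize (a * Q / d) ^ (1 / 2 : ℂ) = r at *
  have has : a * (Q / d) = r * r := by rw [hr, mul_div_assoc]
  congr 1
  · simp only [qPochInfList, List.map_cons, List.map_nil, List.prod_cons, List.prod_nil, mul_one]
    rw [show a * q * (Q / d) * Q⁻¹ = q * a / d by field_simp,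
      show q * (Q / d) * Q⁻¹ * w = q * w / d by field_simp,
      show q * (Q / d) * Q⁻¹ * w⁻¹ = q * w⁻¹ / d by field_simp,
      show q * (Q / d) * w = q * Q * w / d by ring,
      show q * (Q / d) * w⁻¹ = q * Q * w⁻¹ / d by ring,
      show a * q * (Q / d) = q * Q * a / d by ring]
    simp only [mul_assoc]
  · refine tsum_congr fun k => ?_
    -- A zero of (±r; q)_k would give r²q^{2j} = 1, which genericity excludes at the even index 2j.
    have hrk : ∀ (z : ℂ), z * z = r * r → qPoch q z k ≠ 0 := fun z hz =>
      qPoch_ne_zero fun j _ hj => hs.a_ne (2 * j) (by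
        rw [has, ← hz, two_mul, pow_add]
        linear_combination (z * q ^ j + 1) * hj)
    have n1 := hrk r rfl
    have n2 := hrk (-r) (by ring)
    have n3 : 1 - r * r ≠ 0 := by
      rw [← has]
      exact sub_ne_zero.2 (by simpa using (hs.a_ne 0).symm)
    have e3 := qPoch_very_well_poised q r k
    rw [← eq_div_iff n3] at e3
    -- Combining (q^{-ν}; q)_k with the power of bcq^ν gives a polynomial in q^ν, regular at ε = 0
    -- as the identity theorem needs.
    have e4 : qPoch q Q k * (b * c * Q⁻¹) ^ k =
        ∏ j ∈ Finset.range k, (Q⁻¹ - q ^ j) * (b * c) := by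
      have : ∏ _j ∈ Finset.range k, (b * c * Q⁻¹) = (b * c * Q⁻¹) ^ k := by simp
      rw [qPoch, ← this, ← Finset.prod_mul_distrib]
      refine Finset.prod_congr rfl fun j _ => ?_
      field_simp
    simp only [qPochList, List.map_cons, List.map_nil, List.prod_cons, List.prod_nil, mul_one,
      List.length_cons, List.length_nil, wpTerm]
    rw [← e4, has, mul_div_assoc a Q d, has, show q * (Q / d) / b = q * Q / (b * d) by field_simp,
      show q * (Q / d) / c = q * Q / (c * d) by field_simp,
      show a * q * (Q / d) * Q⁻¹ = a * q / d by field_simp,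
      show q * (Q / d) * w = q * Q * w / d by ring,
      show q * (Q / d) * w⁻¹ = q * Q * w⁻¹ / d by ring]
    rw [show (1 + ((0 + 1 + 1 + 1 + 1 + 1 + 1 + 1 : ℕ) : ℤ) -
      ((0 + 1 + 1 + 1 + 1 + 1 + 1 + 1 + 1 : ℕ) : ℤ)) = 0 by norm_num, zpow_zero, mul_one]
    rw [← mul_assoc (qPoch q (q * r) k), ← mul_assoc (qPoch q r k), e3]
    generalize qPoch q r k = X1 at *
    generalize qPoch q (-r) k = X2 at *
    have n4 : X1 * X2 ≠ 0 := mul_ne_zero n1 n2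
    generalize X1 * X2 = X at *
    clear * - n4
    generalize qPoch q (r * r) k = Y1
    generalize qPoch q Q k = Y2
    generalize qPoch q (q * Q / (b * d)) k = Y3
    generalize qPoch q (q * Q / (c * d)) k = Y4
    generalize qPoch q (a * w) k = Y5
    generalize qPoch q (a * w⁻¹) k = Y6
    generalize qPoch q q k = Y7
    generalize qPoch q (a * q / d) k = Y8
    generalize qPoch q (a * b) k = Y9
    generalize qPoch q (a * c) k = Y10
    generalize qPoch q (q * Q * w / d) k = Y11
    generalize qPoch q (q * Q * w⁻¹ / d) k = Y12
    generalize (b * c * Q⁻¹) ^ k = Y13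
    generalize 1 - r * r = Y14
    generalize 1 - r * r * q ^ (2 * k) = Y15
    trans Y15 / Y14 * (Y1 * Y3 * Y4 * Y5 * Y6 / (Y7 * Y9 * Y10 * Y11 * Y12)) * (Y2 * Y13 / Y8) *
      (X * X⁻¹)
    · ring
    · rw [mul_inv_cancel₀ n4, mul_one]

theorem eventually_qPochInf_ne_zero {q : ℂ} (hq : ‖q‖ < 1) (x : ℂ) :
    ∀ᶠ z in 𝓝[≠] x, qPochInf q z ≠ 0 := by
  have h : AnalyticOnNhd ℂ (qPochInf q) Set.univ :=
    (differentiable_qPochInf hq).differentiableOn.analyticOnNhd isOpen_univ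
  by_contra hc
  have h2 := h.eqOn_zero_of_preconnected_of_frequently_eq_zero isPreconnected_univ
    (Set.mem_univ x) ((not_eventually.1 hc).mono fun _ hz => not_not.1 hz) (Set.mem_univ 0)
  simp at h2

/-- The zeros of (z; q)_∞ are isolated, and μ ↦ aq^{-μ}/d has nonzero derivative, hence maps
punctured neighbourhoods to punctured neighbourhoods. The other two conditions persist by
continuity. -/
theorem eventually_genericShift {q a w d ν : ℂ} (hq : ‖q‖ < 1) (hq0 : q ≠ 0) (ha : a ≠ 0)
    (hd : d ≠ 0) (h1 : qPochInf q (q * (q ^ (-ν) / d) * w) ≠ 0)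
    (h2 : qPochInf q (q * (q ^ (-ν) / d) * w⁻¹) ≠ 0) :
    ∀ᶠ μ in 𝓝[≠] ν, GenericShift q a w (q ^ (-μ) / d) := by
  have hl : Complex.log q ≠ 0 := fun h => by
    have := Complex.exp_log hq0
    rw [h, Complex.exp_zero] at this
    rw [← this, norm_one] at hq
    exact lt_irrefl _ hq
  have hp : ∀ μ : ℂ, q ^ μ ≠ 0 := fun μ =>
    mt (fun h => (Complex.cpow_eq_zero_iff _ _).1 h |>.1) hq0
  have hder : HasDerivAt (fun μ : ℂ => q ^ (-μ)) (q ^ (-ν) * Complex.log q * (-1)) ν :=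
    (hasDerivAt_neg ν).const_cpow (Or.inl hq0)
  have hder2 : HasDerivAt (fun μ : ℂ => a * (q ^ (-μ) / d))
      (a * (q ^ (-ν) * Complex.log q * (-1) / d)) ν := (hder.div_const d).const_mul a
  have t1 := hder2.tendsto_nhdsNE (by
    refine mul_ne_zero ha (div_ne_zero (mul_ne_zero (mul_ne_zero (hp _) hl) ?_) hd)
    norm_num)
  have hc : ContinuousAt (fun μ : ℂ => q ^ (-μ)) ν := hder.continuousAt
  have hqc := continuous_qPochInf hq
  have t2 : ∀ᶠ μ in 𝓝 ν, qPochInf q (q * (q ^ (-μ) / d) * w) ≠ 0 :=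
    (hqc.continuousAt.comp (f := fun μ : ℂ => q * (q ^ (-μ) / d) * w)
      (((hc.div_const d).const_mul q).mul_const w)).eventually_ne h1
  have t3 : ∀ᶠ μ in 𝓝 ν, qPochInf q (q * (q ^ (-μ) / d) * w⁻¹) ≠ 0 :=
    (hqc.continuousAt.comp (f := fun μ : ℂ => q * (q ^ (-μ) / d) * w⁻¹)
      (((hc.div_const d).const_mul q).mul_const w⁻¹)).eventually_ne h2
  filter_upwards [t1.eventually (eventually_qPochInf_ne_zero hq _),
    nhdsWithin_le_nhds t2, nhdsWithin_le_nhds t3] with μ m1 m2 m3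
  exact ⟨div_ne_zero (hp _) hd, mul_pow_ne_one_of_qPochInf_ne_zero hq m1, m2, m3⟩

theorem continuousAt_expansion {q a b c w d : ℂ} (h : Params q a b c w) (hd : d ≠ 0)
    (hqd : ‖q / d‖ < 1) (ν : ℂ) :
    ContinuousAt (fun μ : ℂ => expansion q a b c w (q ^ (-μ) / d) (q ^ μ)) ν := by
  have hq0 := h.q_ne
  have hp : ∀ μ : ℂ, q ^ μ ≠ 0 := fun μ =>
    mt (fun h => (Complex.cpow_eq_zero_iff _ _).1 h |>.1) hq0
  have D1 : Differentiable ℂ fun μ : ℂ => q ^ μ := fun μ =>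
    (differentiableAt_id).const_cpow (Or.inl hq0)
  have D2 : Differentiable ℂ fun μ : ℂ => q ^ (-μ) := fun μ =>
    (differentiableAt_id.neg).const_cpow (Or.inl hq0)
  have key : ∀ {v : ℂ}, ‖v‖ = 1 → qPochInf q (q * v⁻¹ ^ 2) ≠ 0 → ∀ y : ℂ, ‖y‖ = 1 →
      ContinuousAt (fun μ : ℂ => branchSeries q a b c v (a * b * c * q ^ μ * y)
        (q * (q ^ (-μ) / d) * y) (q * (q ^ (-μ) / d) * q ^ μ * y)) ν := by
    intro v hv hv' y hy
    -- As sε = 1/d, the argument in the denominator is constant in μ, of modulus ‖q/d‖ < 1.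
    have e : ∀ μ : ℂ, q * (q ^ (-μ) / d) * q ^ μ * y = q / d * y := fun μ => by
      have := hp μ
      rw [Complex.cpow_neg]
      field_simp
    simp only [e]
    have C1 : Continuous fun μ : ℂ => ‖a * b * c * q ^ μ * y‖ :=
      ((D1.continuous.const_mul (a * b * c)).mul_const y).norm
    have C2 : Continuous fun μ : ℂ => ‖q * (q ^ (-μ) / d) * y‖ :=
      (((D2.continuous.div_const d).const_mul q).mul_const y).norm
    set R := max (‖a * b * c * q ^ ν * y‖ + 1) (‖q * (q ^ (-ν) / d) * y‖ + 1) with hR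
    have hU : IsOpen {μ : ℂ | ‖a * b * c * q ^ μ * y‖ < R ∧ ‖q * (q ^ (-μ) / d) * y‖ < R} :=
      (isOpen_lt C1 continuous_const).inter (isOpen_lt C2 continuous_const)
    refine (differentiableOn_branchSeries h.q_lt a b c hv' hU
      ((D1.const_mul _).mul_const _) (((D2.div_const d).const_mul q).mul_const y)
      (differentiable_const _) (R := R) (ρ := ‖q / d‖) hqd (fun z hz => hz.1.le)
      (fun z hz => hz.2.le) (fun z hz => by rw [norm_mul, hy, mul_one])).continuousOn.continuousAt
      (hU.mem_nhds ⟨lt_max_of_lt_left (lt_add_one _), lt_max_of_lt_right (lt_add_one _)⟩)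
  exact (continuousAt_const.mul (key h.norm_w h.admissible.snd w⁻¹ h.inv.norm_w)).add
    (continuousAt_const.mul (key h.inv.norm_w h.inv.admissible.snd w h.norm_w))

/-- Away from the zeros of `(q^{1-ν} w^{±1} / d; q)_∞`, the two-term expansion gives `u_ν`. -/
theorem uFun_eq_expansion {q a b c w d ν : ℂ} (h : Params q a b c w) (hd : d ≠ 0)
    (hqd : ‖q / d‖ < 1) (hν : ‖b * c * q ^ ν‖ < 1)
    (h1 : qPochInf q (q * (q ^ (-ν) / d) * w) ≠ 0)
    (h2 : qPochInf q (q * (q ^ (-ν) / d) * w⁻¹) ≠ 0) :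
    uFun q a b c d w ν = (qPochInf q (a * b) * qPochInf q (a * c) * qPochInf q (b * c))⁻¹ *
      expansion q a b c w (q ^ (-ν) / d) (q ^ ν) := by
  have hq0 := h.q_ne
  have hp : ∀ μ : ℂ, q ^ μ ≠ 0 := fun μ =>
    mt (fun h => (Complex.cpow_eq_zero_iff _ _).1 h |>.1) hq0
  have hc : Continuous fun μ : ℂ => ‖b * c * q ^ μ‖ :=
    (Differentiable.continuous fun μ : ℂ =>
      (differentiableAt_id (𝕜 := ℂ)).const_cpow (Or.inl hq0)).const_mul (b * c) |>.norm
  refine Tendsto.limUnder_eq ?_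
  have ht := ((continuousAt_expansion h hd hqd ν).const_mul
    (qPochInf q (a * b) * qPochInf q (a * c) * qPochInf q (b * c))⁻¹).tendsto.mono_left
      (nhdsWithin_le_nhds (s := {ν}ᶜ))
  refine ht.congr' ?_
  filter_upwards [eventually_genericShift h.q_lt hq0 h.a_ne hd h1 h2,
    nhdsWithin_le_nhds (hc.continuousAt.eventually_lt continuousAt_const hν)] with μ g1 g2
  rw [uSeries_eq_wpSeries hq0 hd g1, ← wpSeries_eq_expansion h g1 g2 ?_,
    inv_mul_cancel_left₀ (mul_ne_zero (mul_ne_zero h.ab_ne h.ac_ne) h.bc_ne)]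
  have e : q * (q ^ (-μ) / d) * q ^ μ = q / d := by
    have := hp μ
    rw [Complex.cpow_neg]
    field_simp
  rwa [e]

/-! ### Asymptotics along real multiples of a nonreal number. -/

theorem ofReal_mul_ne_one {r : ℝ} {z : ℂ} (hz : z.im ≠ 0) : (r : ℂ) * z ≠ 1 := by
  intro h
  have h1 := congrArg Complex.im h
  have h2 := congrArg Complex.re h
  simp only [Complex.im_ofReal_mul, Complex.one_im, mul_eq_zero, hz, or_false] at h1
  simp [h1] at h2

theorem qPochInf_ofReal_mul_ne_zero {t : ℝ} (ht : ‖(t : ℂ)‖ < 1) {z : ℂ} (hz : z.im ≠ 0) (r : ℝ) :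
    qPochInf t (r * z) ≠ 0 :=
  qPochInf_ne_zero ht fun k => by
    have := ofReal_mul_ne_one (r := r * t ^ k) hz
    rwa [Complex.ofReal_mul, Complex.ofReal_pow, mul_right_comm] at this

/-- Uniform lower bound for `(r z; q)_k`, `r` real, on a line that avoids the positive axis. -/
theorem exists_norm_inv_qPoch_ofReal_mul_le {t : ℝ} (ht : ‖(t : ℂ)‖ < 1) {z : ℂ} (hz : z.im ≠ 0)
    (hz1 : ‖z‖ = 1) : ∃ C, 0 < C ∧ ∀ (k : ℕ) (r : ℝ), ‖(qPoch t (r * z) k)⁻¹‖ ≤ C := by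
  have hK : IsCompact ((fun r : ℝ => (r : ℂ) * z) '' Set.Icc (-2) 2) :=
    isCompact_Icc.image (by fun_prop)
  obtain ⟨C, hC0, hC⟩ := exists_norm_inv_qPoch_le ht hK (by
    rintro _ ⟨r, -, rfl⟩
    exact qPochInf_ofReal_mul_ne_zero ht hz r)
  refine ⟨max 1 C, by positivity, fun k => ?_⟩
  induction k with
  | zero => simp
  | succ k ih =>
    intro r
    -- Compactness covers |r| ≤ 2. Otherwise the first factor has modulus at least 1 and can be
    -- dropped, replacing r by rt; this is why the induction keeps r general.
    by_cases hr : |r| ≤ 2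
    · exact ((hC _ ⟨r, abs_le.1 hr, rfl⟩).2 _).trans (le_max_right _ _)
    · have h1 : 1 ≤ ‖1 - (r : ℂ) * z‖ := by
        have := norm_sub_norm_le ((r : ℂ) * z) 1
        rw [norm_mul, hz1, mul_one, Complex.norm_real, Real.norm_eq_abs, norm_one,
          norm_sub_rev] at this
        linarith [not_le.1 hr]
      have h2 := ih (r * t)
      rw [Complex.ofReal_mul, mul_right_comm] at h2
      rw [qPoch_succ_left, mul_inv, norm_mul, norm_inv]
      exact (mul_le_of_le_one_left (norm_nonneg _) (inv_le_one_of_one_le₀ h1)).trans h2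

/-- Factor by factor, 1 - x/q^j = -(x/q^j)(1 - q^j/x). This is the source of the growth in the
asymptotic formula. -/
theorem qPoch_div_pow {q x : ℂ} (hq0 : q ≠ 0) (hx : x ≠ 0) (m : ℕ) :
    qPoch q (x / q ^ m) m = (-x) ^ m * (q ^ ((m + 1) * m / 2))⁻¹ * qPoch q (q / x) m := by
  induction m with
  | zero => simp
  | succ m ih =>
    have e1 : x / q ^ (m + 1) * q = x / q ^ m := by
      rw [pow_succ]
      field_simp
    have e2 : (m + 1 + 1) * (m + 1) / 2 = (m + 1) * m / 2 + (m + 1) := by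
      rw [show (m + 1 + 1) * (m + 1) = (m + 1) * m + (m + 1) * 2 by ring,
        Nat.add_mul_div_right _ _ two_pos]
    rw [qPoch_succ_left, e1, ih, qPoch_succ, e2, pow_add q ((m + 1) * m / 2),
      pow_succ (-x)]
    have h1 : q ^ ((m + 1) * m / 2) ≠ 0 := pow_ne_zero _ hq0
    generalize q ^ ((m + 1) * m / 2) = Y at *
    rw [pow_succ q m]
    have h2 : q ^ m ≠ 0 := pow_ne_zero _ hq0
    generalize q ^ m = Z at *
    generalize qPoch q (q / x) m = W
    field_simp
    ring

theorem qPochInf_div_pow {q x : ℂ} (hq : ‖q‖ < 1) (hq0 : q ≠ 0) (hx : x ≠ 0) (m : ℕ) :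
    qPochInf q (x / q ^ m) =
      (-x) ^ m * (q ^ ((m + 1) * m / 2))⁻¹ * qPoch q (q / x) m * qPochInf q x := by
  rw [qPochInf_eq_mul hq _ m, qPoch_div_pow hq0 hx, div_mul_cancel₀ _ (pow_ne_zero _ hq0)]

/-- Only the first term of the balanced series survives in the limit. -/
theorem tendsto_branchSeries_div {t : ℝ} {a b c w : ℂ} (h : Params t a b c w) (hw : w.im ≠ 0)
    {v : ℂ} (hv : ‖v‖ < 1) {x : ℕ → ℂ} (hx : Tendsto x atTop (𝓝 0)) {r : ℕ → ℝ}
    (hr : Tendsto (fun m => |r m|) atTop atTop) :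
    Tendsto (fun m => branchSeries t a b c w (x m) (r m * w⁻¹) v / qPochInf t (r m * w⁻¹)) atTop
      (𝓝 (qPochInf t v)⁻¹) := by
  have hq := h.q_lt
  have hz : (w⁻¹).im ≠ 0 := by
    rw [Complex.inv_im]
    exact div_ne_zero (neg_ne_zero.2 hw) (Complex.normSq_eq_zero.not.2 h.w_ne)
  have hz1 := h.inv.norm_w
  obtain ⟨D, hD0, hD⟩ := exists_norm_inv_qPoch_ofReal_mul_le hq hz hz1
  obtain ⟨R, hR⟩ := hx.norm.bddAbove_range
  obtain ⟨C, hC0, hC⟩ := exists_norm_branchTerm_le hq b c h.admissible.snd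
    (max ‖a‖ (max R 0)) hv
  have hterm : ∀ m k, branchTerm t a b c w (x m) (r m * w⁻¹) v k / qPochInf t (r m * w⁻¹) =
      branchTerm t a b c w (x m) 0 v k * (qPoch t (r m * w⁻¹) k)⁻¹ := fun m k => by
    have n1 := qPochInf_ofReal_mul_ne_zero hq hz (r m)
    have e := qPochInf_eq_mul hq (r m * w⁻¹) k
    have n2 := n1
    rw [e] at n2
    have n3 := left_ne_zero_of_mul n2
    have n4 := right_ne_zero_of_mul n2
    rw [branchTerm, branchTerm, e, zero_mul, qPochInf_zero]
    generalize qPoch (t : ℂ) (r m * w⁻¹) k = X at *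
    generalize qPochInf (t : ℂ) (r m * w⁻¹ * t ^ k) = Y at *
    trans branchCoeff t a b c w k * t ^ k * (qPochInf t (x m * t ^ k) * 1 /
      qPochInf t (v * t ^ k)) * X⁻¹ * (Y * Y⁻¹)
    · ring
    · rw [mul_inv_cancel₀ n4, mul_one]
  have hlim : (qPochInf (t : ℂ) v)⁻¹ = ∑' k : ℕ, if k = 0 then (qPochInf (t : ℂ) v)⁻¹ else 0 := by
    rw [tsum_ite_eq]
  simp only [branchSeries, ← tsum_div_const, hterm]
  rw [hlim]
  refine tendsto_tsum_of_dominated_convergence ((summable_geometric_const hq C).mul_right D)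
    (fun k => ?_) (.of_forall fun m k => ?_)
  · cases k with
    | zero =>
      have := ((continuous_qPochInf hq).tendsto 0).comp hx
      simpa [branchTerm, branchCoeff, Function.comp_def] using this.div_const (qPochInf t v)
    | succ k =>
      rw [if_neg (Nat.succ_ne_zero k)]
      -- For k ≥ 1 the factor 1 - r w⁻¹ in the denominator tends to infinity, while the remaining
      -- ones stay uniformly bounded below.
      have hbig : Tendsto (fun m => ‖1 - (r m : ℂ) * w⁻¹‖) atTop atTop := by
        refine tendsto_atTop_mono (fun m => ?_) (tendsto_atTop_add_const_right _ (-1) hr)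
        have := norm_sub_norm_le ((r m : ℂ) * w⁻¹) 1
        rw [norm_mul, hz1, mul_one, Complex.norm_real, Real.norm_eq_abs, norm_one,
          norm_sub_rev] at this
        linarith
      have h0 : Tendsto (fun m => C * ‖(t : ℂ)‖ ^ (k + 1) * (‖1 - (r m : ℂ) * w⁻¹‖⁻¹ * D)) atTop
          (𝓝 0) := by
        simpa using ((tendsto_inv_atTop_zero.comp hbig).mul_const D).const_mul
          (C * ‖(t : ℂ)‖ ^ (k + 1))
      refine squeeze_zero_norm (fun m => ?_) h0
      rw [norm_mul, qPoch_succ_left, mul_inv, norm_mul, norm_inv (1 - _)]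
      have h1 := hC a (x m) 0 v (le_max_left _ _)
        (((hR ⟨m, rfl⟩).trans (le_max_left _ _)).trans (le_max_right _ _)) (by simp) le_rfl (k + 1)
      have h2 := hD k (r m * t)
      rw [Complex.ofReal_mul, mul_right_comm] at h2
      gcongr
  · rw [norm_mul]
    have h1 := hC a (x m) 0 v (le_max_left _ _)
        (((hR ⟨m, rfl⟩).trans (le_max_left _ _)).trans (le_max_right _ _)) (by simp) le_rfl k
    have h2 := hD k (r m)
    gcongr

/-- The amplitude of the `w⁻ᵐ`-component of `u_{γ_{m+1}}`; it converges to `ampA`. -/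
noncomputable def ampSeq (q a b c d α w : ℂ) (m : ℕ) : ℂ :=
  branchPre q a b c w * qPochInf q (α * w⁻¹) * qPoch q (q / (α * w⁻¹)) m *
    (branchSeries q a b c w (a * b * c * (q ^ (m + 1) / (α * d)) * w⁻¹) (α / q ^ m * w⁻¹)
      (q / d * w⁻¹) / qPochInf q (α / q ^ m * w⁻¹))

theorem tendsto_abs_div_pow {t α : ℝ} (ht0 : t ≠ 0) (ht : |t| < 1) (hα : α ≠ 0) :
    Tendsto (fun m : ℕ => |α / t ^ m|) atTop atTop := by
  have h := tendsto_pow_atTop_atTop_of_one_lt (one_lt_inv_iff₀.2 ⟨abs_pos.2 ht0, ht⟩)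
  refine (h.const_mul_atTop (abs_pos.2 hα)).congr fun m => ?_
  rw [abs_div, abs_pow, inv_pow, div_eq_mul_inv]

theorem tendsto_ampSeq {t d α : ℝ} {a b c w : ℂ} (h : Params t a b c w) (hw : w.im ≠ 0)
    (hα : α ≠ 0) (hd : |t| < |d|) :
    Tendsto (ampSeq t a b c d α w) atTop (𝓝 (ampA t a b c d α w)) := by
  have hq := h.q_lt
  have ht0 : t ≠ 0 := by exact_mod_cast h.q_ne
  have ht : |t| < 1 := by simpa using hq
  have hd0 : 0 < |d| := (abs_nonneg t).trans_lt hd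
  have hv : ‖(t : ℂ) / d * w⁻¹‖ < 1 := by
    rw [norm_mul, h.inv.norm_w, mul_one, norm_div, Complex.norm_real, Complex.norm_real]
    exact (div_lt_one hd0).2 hd
  have hx : Tendsto (fun m : ℕ => a * b * c * ((t : ℂ) ^ (m + 1) / (α * d)) * w⁻¹) atTop (𝓝 0) := by
    have := (((tendsto_pow_atTop_nhds_zero_of_norm_lt_one hq).comp
      (tendsto_add_atTop_nat 1)).div_const ((α : ℂ) * d)).const_mul (a * b * c) |>.mul_const w⁻¹
    simpa using this
  have h1 := tendsto_branchSeries_div h hw hv hx (tendsto_abs_div_pow ht0 ht hα)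
  have h2 := ((tendsto_qPoch hq (t / (α * w⁻¹))).const_mul
    (branchPre t a b c w * qPochInf t (α * w⁻¹))).mul h1
  refine Tendsto.congr (fun m => ?_) (h2.trans_eq (congrArg 𝓝 ?_))
  · simp only [ampSeq]
    push_cast
    rfl
  · have e : (t : ℂ) / (α * w⁻¹) = t * w / α := by
      have := h.w_ne
      field_simp
    rw [e]
    simp only [ampA, branchPre, qPochInfList, List.map_cons, List.map_nil, List.prod_cons,
      List.prod_nil, mul_one]
    rw [show (t : ℂ) * w⁻¹ / d = t / d * w⁻¹ by ring]
    ring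

/-- The choice of ν makes qs = α/q^m real and qsε = q/d. Pulling (αw^{∓1}/q^m; q)_∞ out of each
branch produces the common growth factor and w^{∓m}. Since w is not real, these products never
vanish, so the expansion applies. -/
theorem uFun_eq_ampSeq {t d α : ℝ} {a b c w ν : ℂ} (h : Params t a b c w) (hw : w.im ≠ 0)
    (hα : α ≠ 0) (hd : |t| < |d|) (m : ℕ) (hν : (t : ℂ) ^ ν = (t : ℂ) ^ (m + 1) / (α * d))
    (hν1 : ‖b * c * (t : ℂ) ^ ν‖ < 1) :
    uFun t a b c d w ν = (-(α : ℂ)) ^ m * ((t : ℂ) ^ ((m + 1) * m / 2))⁻¹ *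
      (qPochInf t (a * b) * qPochInf t (a * c) * qPochInf t (b * c))⁻¹ *
      (w⁻¹ ^ m * ampSeq t a b c d α w m + w ^ m * ampSeq t a b c d α w⁻¹ m) := by
  have hq := h.q_lt
  have hq0 := h.q_ne
  have hw0 := h.w_ne
  have hz : (w⁻¹).im ≠ 0 := by
    rw [Complex.inv_im]
    exact div_ne_zero (neg_ne_zero.2 hw) (Complex.normSq_eq_zero.not.2 h.w_ne)
  have hd0 : 0 < |d| := (abs_nonneg t).trans_lt hd
  have hdc : (d : ℂ) ≠ 0 := Complex.ofReal_ne_zero.2 (abs_pos.1 hd0)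
  have hαc : (α : ℂ) ≠ 0 := Complex.ofReal_ne_zero.2 hα
  have hqd : ‖(t : ℂ) / d‖ < 1 := by
    rw [norm_div, Complex.norm_real, Complex.norm_real]
    exact (div_lt_one hd0).2 hd
  have e1 : (t : ℂ) * ((t : ℂ) ^ (-ν) / d) = α / t ^ m := by
    rw [Complex.cpow_neg, hν, pow_succ]
    field_simp
  have e2 : (α : ℂ) / t ^ m = ((α / t ^ m : ℝ) : ℂ) := by push_cast; rfl
  have n1 : qPochInf t ((α : ℂ) / t ^ m * w) ≠ 0 := by
    rw [e2]; exact qPochInf_ofReal_mul_ne_zero hq hw _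
  have n2 : qPochInf t ((α : ℂ) / t ^ m * w⁻¹) ≠ 0 := by
    rw [e2]; exact qPochInf_ofReal_mul_ne_zero hq hz _
  rw [uFun_eq_expansion h hdc hqd hν1 (by rwa [e1]) (by rwa [e1]), expansion, e1, hν]
  have e3 : (α : ℂ) / t ^ m * ((t : ℂ) ^ (m + 1) / (α * d)) = t / d := by
    rw [pow_succ]
    field_simp
  rw [e3, ampSeq, ampSeq, inv_inv]
  have f1 := qPochInf_div_pow hq hq0 (mul_ne_zero hαc hw0) m
  have f2 := qPochInf_div_pow hq hq0 (mul_ne_zero hαc h.inv.w_ne) m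
  rw [mul_div_right_comm] at f1 f2
  have g1 : ∀ {X B P u : ℂ}, X ≠ 0 → X = (-(α * u)) ^ m * ((t : ℂ) ^ ((m + 1) * m / 2))⁻¹ * P →
      B = (-(α : ℂ)) ^ m * ((t : ℂ) ^ ((m + 1) * m / 2))⁻¹ * (u ^ m * (P * (B / X))) := by
    intro X B P u hX hXe
    rw [neg_mul_eq_neg_mul, mul_pow] at hXe
    trans X * (B / X)
    · field_simp
    · nth_rw 1 [hXe]
      ring
  have k1 := g1 (B := branchSeries t a b c w (a * b * c * ((t : ℂ) ^ (m + 1) / (α * d)) * w⁻¹)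
    (α / t ^ m * w⁻¹) (t / d * w⁻¹)) n2 (f2.trans (mul_assoc _ _ _))
  have k2 := g1 (B := branchSeries t a b c w⁻¹ (a * b * c * ((t : ℂ) ^ (m + 1) / (α * d)) * w)
    (α / t ^ m * w) (t / d * w)) n1 (f1.trans (mul_assoc _ _ _))
  linear_combination (qPochInf t (a * b) * qPochInf t (a * c) * qPochInf t (b * c))⁻¹ *
    (branchPre t a b c w * k1 + branchPre t a b c w⁻¹ * k2)

/-! ### Conjugate amplitudes, the weight, and the conclusion. -/

theorem conj_qPochInf {t : ℝ} (ht : ‖(t : ℂ)‖ < 1) (x : ℂ) :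
    starRingEnd ℂ (qPochInf t x) = qPochInf t (starRingEnd ℂ x) := by
  rw [qPochInf, (multipliable_qPochInf ht x).map_tprod _ Complex.continuous_conj, qPochInf]
  exact tprod_congr fun k => by simp

/-- Conjugation sends w to w⁻¹, fixes q, α, d, and at most permutes a, b, c, in which the amplitude
is symmetric. -/
theorem conj_ampA {t d α : ℝ} {a b c w : ℂ} (h : Params t a b c w)
    (habc : (a.im = 0 ∧ b.im = 0 ∧ c.im = 0) ∨
      (b = starRingEnd ℂ a ∧ c.im = 0) ∨
      (c = starRingEnd ℂ a ∧ b.im = 0) ∨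
      (c = starRingEnd ℂ b ∧ a.im = 0)) :
    starRingEnd ℂ (ampA t a b c d α w) = ampA t a b c d α w⁻¹ := by
  have hw : starRingEnd ℂ w = w⁻¹ := by
    rw [Complex.inv_def, Complex.normSq_eq_norm_sq, h.norm_w]
    simp
  simp only [ampA, qPochInfList, List.map_cons, List.map_nil, List.prod_cons, List.prod_nil,
    mul_one, map_div₀, map_mul, map_pow, map_inv₀, conj_qPochInf h.q_lt, Complex.conj_ofReal, hw]
  congr 1
  rcases habc with ⟨h1, h2, h3⟩ | ⟨h1, h2⟩ | ⟨h1, h2⟩ | ⟨h1, h2⟩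
  · rw [Complex.conj_eq_iff_im.2 h1, Complex.conj_eq_iff_im.2 h2, Complex.conj_eq_iff_im.2 h3]
  · rw [h1, Complex.conj_eq_iff_im.2 h2, Complex.conj_conj]
    ring
  · rw [h1, Complex.conj_eq_iff_im.2 h2, Complex.conj_conj]
    ring
  · rw [h1, Complex.conj_eq_iff_im.2 h2, Complex.conj_conj]
    ring

/-- The factors with α are nonzero because w is not real, the factor (w²; q)_∞ because w² ≠ 1, the
others because their arguments have modulus below 1. -/
theorem ampA_ne_zero {t d α : ℝ} {a b c w : ℂ} (h : Params t a b c w) (hw : w.im ≠ 0)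
    (hd : |t| < |d|) : ampA t a b c d α w ≠ 0 := by
  have hq := h.q_lt
  have hz : (w⁻¹).im ≠ 0 := by
    rw [Complex.inv_im]
    exact div_ne_zero (neg_ne_zero.2 hw) (Complex.normSq_eq_zero.not.2 h.w_ne)
  have hd0 : 0 < |d| := (abs_nonneg t).trans_lt hd
  have n1 : ∀ {x : ℂ}, ‖x‖ < 1 → qPochInf t (x * w) ≠ 0 := fun {x} hx =>
    qPochInf_ne_zero_of_norm_lt_one hq (by rwa [norm_mul, h.norm_w, mul_one])
  have n2 : qPochInf (t : ℂ) (t * w / α) ≠ 0 := by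
    have := qPochInf_ofReal_mul_ne_zero hq hw (t / α)
    rwa [Complex.ofReal_div, div_mul_eq_mul_div] at this
  have n3 : qPochInf (t : ℂ) (t * w⁻¹ / d) ≠ 0 := qPochInf_ne_zero_of_norm_lt_one hq (by
    rw [norm_div, norm_mul, h.inv.norm_w, mul_one, Complex.norm_real, Complex.norm_real]
    exact (div_lt_one hd0).2 hd)
  simp only [ampA, qPochInfList, List.map_cons, List.map_nil, List.prod_cons, List.prod_nil,
    mul_one]
  exact div_ne_zero (mul_ne_zero (n1 h.a_lt) (mul_ne_zero (n1 h.b_lt) (mul_ne_zero (n1 h.c_lt)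
    (mul_ne_zero (qPochInf_ofReal_mul_ne_zero hq hz α) n2))))
    (mul_ne_zero (h.admissible.qPochInf_sq hq) n3)

theorem inv_ampA_mul_ampA_inv (q a b c d α w : ℂ) :
    (ampA q a b c d α w * ampA q a b c d α w⁻¹)⁻¹ = orthWeight q a b c d α w := by
  simp only [ampA, orthWeight, qPochInfList, List.map_cons, List.map_nil, List.prod_cons,
    List.prod_nil, mul_one, inv_inv, mul_inv, div_eq_mul_inv]
  ring

theorem norm_mul_cos_eq (A : ℂ) (m : ℕ) (θ : ℝ) :
    2 * ((‖A‖ * Real.cos (m * θ - A.arg) : ℝ) : ℂ) =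
      (Complex.exp (θ * Complex.I))⁻¹ ^ m * A +
        Complex.exp (θ * Complex.I) ^ m * starRingEnd ℂ A := by
  have h1 : (Complex.exp (θ * Complex.I))⁻¹ ^ m * A +
      starRingEnd ℂ ((Complex.exp (θ * Complex.I))⁻¹ ^ m * A) =
      ((2 * ((Complex.exp (θ * Complex.I))⁻¹ ^ m * A).re : ℝ) : ℂ) := Complex.add_conj _
  have h2 : starRingEnd ℂ (Complex.exp (θ * Complex.I))⁻¹ = Complex.exp (θ * Complex.I) := by
    rw [map_inv₀, ← Complex.exp_conj, ← Complex.exp_neg]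
    simp
  rw [map_mul, map_pow, h2] at h1
  rw [h1]
  have h3 : (Complex.exp (θ * Complex.I))⁻¹ ^ m * A =
      (‖A‖ : ℂ) * Complex.exp (((A.arg - m * θ : ℝ) : ℂ) * Complex.I) := by
    conv_lhs => rw [← Complex.norm_mul_exp_arg_mul_I A]
    rw [← Complex.exp_neg, ← Complex.exp_nat_mul, mul_left_comm, ← Complex.exp_add]
    congr 2
    push_cast
    ring
  rw [h3, Complex.re_ofReal_mul, Complex.exp_ofReal_mul_I_re, ← Real.cos_neg (_ - _), neg_sub]
  push_cast
  ring

theorem theorem5p6 (q d α θ : ℝ) (a b c : ℂ) (γ : ℕ → ℂ)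
    (hq0 : q ≠ 0) (hq1 : |q| < 1)
    (ha0 : a ≠ 0) (hb0 : b ≠ 0) (hc0 : c ≠ 0)
    (ha : ‖a‖ < 1) (hb : ‖b‖ < 1) (hc : ‖c‖ < 1) (hd : |q| < |d|) (hα : α ≠ 0)
    (habc : (a.im = 0 ∧ b.im = 0 ∧ c.im = 0) ∨
      (b = starRingEnd ℂ a ∧ c.im = 0) ∨
      (c = starRingEnd ℂ a ∧ b.im = 0) ∨
      (c = starRingEnd ℂ b ∧ a.im = 0))
    (hθ₁ : -1 < Real.cos θ) (hθ₂ : Real.cos θ < 1)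
    (hγ : ∀ n : ℕ, 1 ≤ n → (q : ℂ) ^ γ n = (q : ℂ) ^ n / ((α : ℂ) * d)) :
    let w : ℂ := Complex.exp (θ * Complex.I)
    let A : ℂ := ampA q a b c d α w
    let χ : ℝ := A.arg
    let P : ℕ → ℂ := fun n =>
      2 * (-(α : ℂ)) ^ (n - 1) * ((q : ℂ) ^ (n * (n - 1) / 2))⁻¹ *
        (qPochInfList q [a * b, a * c, b * c])⁻¹
    ((fun n : ℕ => uFun q a b c d w (γ n) -
        P n * ((‖A‖ * Real.cos (((n : ℝ) - 1) * θ - χ) : ℝ) : ℂ)) =o[atTop] P) ∧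
      A ≠ 0 ∧
      (((‖A‖ ^ 2)⁻¹ : ℝ) : ℂ) = orthWeight q a b c d α w := by
  intro w A χ P
  have hsin : Real.sin θ ≠ 0 := fun h0 => by
    have := Real.sin_sq_add_cos_sq θ
    nlinarith
  have hwim : w.im ≠ 0 := by
    simpa only [w, Complex.exp_ofReal_mul_I_im] using hsin
  have hwn : ‖w‖ = 1 := Complex.norm_exp_ofReal_mul_I θ
  have h : Params q a b c w :=
    { q_lt := by simpa using hq1
      q_ne := Complex.ofReal_ne_zero.2 hq0
      a_ne := ha0
      b_ne := hb0
      c_ne := hc0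
      a_lt := ha
      b_lt := hb
      c_lt := hc
      norm_w := hwn
      w_sq := fun h0 => by
        rcases sq_eq_one_iff.1 h0 with h1 | h1 <;> simp [h1] at hwim }
  have hconj : starRingEnd ℂ A = ampA q a b c d α w⁻¹ := conj_ampA h habc
  have hwim' : (w⁻¹).im ≠ 0 := by
    rw [Complex.inv_im]
    exact div_ne_zero (neg_ne_zero.2 hwim) (Complex.normSq_eq_zero.not.2 h.w_ne)
  refine ⟨?_, ampA_ne_zero h hwim hd, ?_⟩
  · have t1 := tendsto_ampSeq h hwim hα hd
    have t2 := tendsto_ampSeq h.inv hwim' hα hd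
    rw [← hconj] at t2
    -- The relative error, indexed by m = n - 1; since |w| = 1 the oscillating powers do not affect
    -- its size.
    set φ : ℕ → ℂ := fun m => (w⁻¹ ^ m * (ampSeq q a b c d α w m - A) +
      w ^ m * (ampSeq q a b c d α w⁻¹ m - starRingEnd ℂ A)) / 2 with hφ
    have hφ0 : Tendsto φ atTop (𝓝 0) := by
      have s1 : Tendsto (fun m => w⁻¹ ^ m * (ampSeq q a b c d α w m - A)) atTop (𝓝 0) := by
        refine squeeze_zero_norm (fun m => ?_) (tendsto_iff_norm_sub_tendsto_zero.1 t1)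
        rw [norm_mul, norm_pow, h.inv.norm_w, one_pow, one_mul]
      have s2 : Tendsto (fun m => w ^ m * (ampSeq q a b c d α w⁻¹ m - starRingEnd ℂ A)) atTop
          (𝓝 0) := by
        refine squeeze_zero_norm (fun m => ?_) (tendsto_iff_norm_sub_tendsto_zero.1 t2)
        rw [norm_mul, norm_pow, h.norm_w, one_pow, one_mul]
      exact ((s1.add s2).div_const 2).trans_eq (by simp)
    -- The series representation needs ‖bcq^ν‖ < 1, which is available only for large n.
    have hsmall : ∀ᶠ n : ℕ in atTop, ‖b * c * ((q : ℂ) ^ n / (α * d))‖ < 1 := by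
      have := ((tendsto_pow_atTop_nhds_zero_of_norm_lt_one h.q_lt).div_const
        ((α : ℂ) * d)).const_mul (b * c)
      rw [zero_div, mul_zero] at this
      exact this.norm.eventually_lt_const (by simp)
    have hkey : (fun n => P n * φ (n - 1)) =ᶠ[atTop] fun n : ℕ => uFun q a b c d w (γ n) -
        P n * ((‖A‖ * Real.cos (((n : ℝ) - 1) * θ - χ) : ℝ) : ℂ) := by
      filter_upwards [hsmall, eventually_ge_atTop 1] with n hn hn1
      obtain ⟨m, rfl⟩ : ∃ m, n = m + 1 := ⟨n - 1, by omega⟩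
      have e := hγ (m + 1) hn1
      rw [uFun_eq_ampSeq h hwim hα hd m e (by rwa [e])]
      have hcos := norm_mul_cos_eq A m θ
      simp only [P, hφ, Nat.add_sub_cancel, qPochInfList, List.map_cons, List.map_nil,
        List.prod_cons, List.prod_nil, mul_one, Nat.cast_add, Nat.cast_one, add_sub_cancel_right,
        ← mul_assoc (qPochInf (q : ℂ) (a * b))]
      linear_combination (-(α : ℂ)) ^ m * ((q : ℂ) ^ ((m + 1) * m / 2))⁻¹ *
        (qPochInf q (a * b) * qPochInf q (a * c) * qPochInf q (b * c))⁻¹ * hcos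
    refine IsLittleO.congr' ?_ hkey EventuallyEq.rfl
    have := (isBigO_refl P atTop).mul_isLittleO
      ((isLittleO_one_iff ℂ).2 (hφ0.comp (tendsto_sub_atTop_nat 1)))
    simpa using this
  · rw [← inv_ampA_mul_ampA_inv, ← hconj, Complex.mul_conj']
    push_cast
    rfl
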